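/- Let $\Omega\subset\mathbb{R}^3$ be a bounded open set with Lipschitz boundary, let $D_0\in L^\infty(\Omega)$ satisfy $D_0\ge\gamma$ almost everywhere in $\Omega$ for some constant $\gamma>0$, and let $0<\beta,\beta'<1$, $\gamma_1>0$, $\gamma_2>0$. Let $\boldsymbol{j}_e\in H^1(\Omega,\mathbb{R}^3)\cap C^0(\overline\Omega,\mathbb{R}^3)$ and $\boldsymbol{m}\in H^1(\Omega,\mathbb{S}^2)$. Then there is exactly one $\boldsymbol{s}=:\mathcal{H}_s[\boldsymbol{m}]\in H^1(\Omega,\mathbb{R}^3)$ (the spin accumulation) that solves $$-\mathbf{div}\Big(D_0\big[\nabla\boldsymbol{s}-\beta\beta'(\nabla\boldsymbol{s}\cdot\boldsymbol{m})\otimes\boldsymbol{m}\big]-\tfrac{\beta}{2}\,\boldsymbol{j}_e\otimes\boldsymbol{m}\Big)+\gamma_1\boldsymbol{s}+\gamma_2\,\boldsymbol{s}\times\boldsymbol{m}=0\ \text{ in }\Omega,\qquad \partial_{\boldsymbol{n}}\boldsymbol{s}=0\ \text{ on }\partial\Omega,$$ in the weak sense that $\mathbf{div}(\boldsymbol{j}_e\otimes\boldsymbol{m})\in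 L^2(\Omega,\mathbb{R}^3)$ and, for every $\boldsymbol{\varphi}\in H^1(\Omega,\mathbb{R}^3)$, $$\int_\Omega D_0\big[\nabla\boldsymbol{s}-\beta\beta'(\nabla\boldsymbol{s}\cdot\boldsymbol{m})\otimes\boldsymbol{m}\big]:\nabla\boldsymbol{\varphi}+\int_\Omega(\gamma_1\boldsymbol{s}+\gamma_2\,\boldsymbol{s}\times\boldsymbol{m})\cdot\boldsymbol{\varphi}=-\frac{\beta}{2}\int_\Omega\mathbf{div}(\boldsymbol{j}_e\otimes\boldsymbol{m})\cdot\boldsymbol{\varphi}.$$ Here $\nabla\boldsymbol{s}=(\partial_i s_j)_{i,j}$, and $\mathbf{div}$ acts on the columns of a matrix field. Moreover, there is a constant $c_L\ge 0$, depending only on $D_0,\beta,\beta',\gamma_1,\gamma_2$ and $\Omega$, such that for all $\boldsymbol{j}_e\in H^1(\Omega,\mathbb{R}^3)\cap C^0(\overline\Omega,\mathbb{R}^3)$, all $\boldsymbol{m}_1\in C^2(\overline\Omega,\mathbb{S}^2)$ and all $\boldsymbol{m}_2\in H^1(\Omega,\mathbb{S}^2)$, $$\big\|\mathcal{H}_s[\boldsymbol{m}_1]-\mathcal{H}_s[\boldsymbol{m}_2]\big\|_{H^1(\Omega)}^2\le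 c_L^2\Big(\big\|\mathcal{H}_s[\boldsymbol{m}_1]\big\|_{C^1(\overline\Omega)}^2+\|\boldsymbol{j}_e\|_{C^0(\overline\Omega)}^2\Big)\,\|\boldsymbol{m}_1-\boldsymbol{m}_2\|_{H^1(\Omega)}^2,$$ where $\|\boldsymbol{s}\|_{C^1(\overline\Omega)}=\sup_\Omega|\boldsymbol{s}|+\sup_\Omega|\nabla\boldsymbol{s}|$ if $\boldsymbol{s}$ has a representative in $C^1(\overline\Omega)$, and $\|\boldsymbol{s}\|_{C^1(\overline\Omega)}=\infty$ otherwise (with $\infty\cdot 0=0$). -/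

import Mathlib

open MeasureTheory
open scoped ENNReal NNReal Matrix

noncomputable section

/-- Three-dimensional Euclidean space. -/
abbrev R3 : Type := EuclideanSpace ℝ (Fin 3)

/-- Bounded open sets with Lipschitz boundary: near each boundary point, `Ω` is the strict
epigraph, in the direction of a unit vector `ν`, of a Lipschitz function of the remaining
orthogonal coordinates (a Lipschitz function on the space which is invariant under translations
along `ν`). Connectedness is not required. -/
structure IsBoundedLipschitzDomain (Ω : Set R3) : Prop where
  isOpen : IsOpen Ω
  isBounded : Bornology.IsBounded Ω
  lipschitz_boundary : ∀ x ∈ frontier Ω, ∃ r : ℝ, 0 < r ∧ ∃ ν : R3, ‖ν‖ = 1 ∧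
    ∃ (K : ℝ≥0) (g : R3 → ℝ), LipschitzWith K g ∧ (∀ (y : R3) (t : ℝ), g (y + t • ν) = g y) ∧
      Ω ∩ Metric.ball x r = {y | y ∈ Metric.ball x r ∧ g y < inner ℝ ν y}

/-- Scalar test functions on `Ω`: smooth, with compact support contained in `Ω`. -/
structure IsTestFunction (Ω : Set R3) (ψ : R3 → ℝ) : Prop where
  smooth : ContDiff ℝ ((⊤ : ℕ∞) : WithTop ℕ∞) ψ
  compactSupport : HasCompactSupport ψ
  support_subset : tsupport ψ ⊆ Ω

/-- The classical partial derivative `∂ᵢψ`. -/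
def partialDeriv (i : Fin 3) (ψ : R3 → ℝ) (x : R3) : ℝ :=
  fderiv ℝ ψ x (EuclideanSpace.single i 1)

/-- `G i` is, for each `i`, the weak partial derivative `∂ᵢu` in `Ω`, and it is in `L²(Ω)`. -/
structure IsL2WeakGrad (Ω : Set R3) (u : R3 → R3) (G : Fin 3 → R3 → R3) : Prop where
  memLp : ∀ i, MemLp (G i) 2 (volume.restrict Ω)
  integral_eq : ∀ ψ, IsTestFunction Ω ψ → ∀ i,
    ∫ x in Ω, partialDeriv i ψ x • u x = - ∫ x in Ω, ψ x • G i x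

/-- `u` (through its values almost everywhere in `Ω`) belongs to `H¹(Ω, ℝ³)`. -/
structure IsH1 (Ω : Set R3) (u : R3 → R3) : Prop where
  memLp : MemLp u 2 (volume.restrict Ω)
  exists_grad : ∃ G, IsL2WeakGrad Ω u G

/-- `u` belongs to `H¹(Ω, 𝕊²)`. -/
structure IsH1Sphere (Ω : Set R3) (u : R3 → R3) : Prop where
  isH1 : IsH1 Ω u
  norm_eq_one : ∀ᵐ x ∂(volume.restrict Ω), ‖u x‖ = 1

/-- The weak gradient of `u`; `weakGrad Ω u i` is `∂ᵢu`. It is determined up to null sets, and it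
is used only for `u` in `H¹(Ω, ℝ³)`. -/
def weakGrad (Ω : Set R3) (u : R3 → R3) : Fin 3 → R3 → R3 :=
  Classical.epsilon (IsL2WeakGrad Ω u)

/-- `‖u‖²` in `H¹(Ω)`, for `u` in `H¹(Ω, ℝ³)`. -/
def h1NormSq (Ω : Set R3) (u : R3 → R3) : ℝ≥0∞ :=
  (∫⁻ x in Ω, ‖u x‖ₑ ^ 2) + ∑ i, ∫⁻ x in Ω, ‖weakGrad Ω u i x‖ₑ ^ 2

/-- `f` belongs to `Cᵏ` of the closure of `Ω`: it is `Cᵏ` in the open set `Ω`, and its derivatives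
of order at most `k` extend continuously to the closure. -/
structure IsCkClosure (k : ℕ) (Ω : Set R3) (f : R3 → R3) : Prop where
  contDiffOn : ContDiffOn ℝ k f Ω
  extends_continuously : ∀ i : ℕ, i ≤ k →
    ∃ G : R3 → ContinuousMultilinearMap ℝ (fun _ : Fin i => R3) R3,
      ContinuousOn G (closure Ω) ∧ ∀ x ∈ Ω, G x = iteratedFDeriv ℝ i f x

/-- The norm of `C⁰` of the closure of `Ω`. -/
def c0Norm (Ω : Set R3) (f : R3 → R3) : ℝ≥0∞ :=
  ⨆ x ∈ closure Ω, ‖f x‖ₑ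

/-- The norm of `C¹` of the closure of `Ω`, for an almost everywhere class: it is
`sup |v| + sup |∇v|` for the `C¹` representative `v` (unique in `Ω`), and `∞` if there is none. -/
def c1Norm (Ω : Set R3) (f : R3 → R3) : ℝ≥0∞ :=
  ⨅ (v : R3 → R3) (_ : IsCkClosure 1 Ω v ∧ v =ᵐ[volume.restrict Ω] f),
    ((⨆ x ∈ Ω, ‖v x‖ₑ) + ⨆ x ∈ Ω, ‖fderiv ℝ v x‖ₑ)

/-- The cross product of `ℝ³`. -/
def cross (a b : R3) : R3 :=
  WithLp.toLp 2 (a.ofLp ⨯₃ b.ofLp)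

/-- The matrix field with rows `A k` has the weak divergence `F` in `Ω`; the divergence acts on
columns, so that `Fᵢ = ∑ₖ ∂ₖ (A k)ᵢ`. -/
def HasWeakDiv (Ω : Set R3) (A : Fin 3 → R3 → R3) (F : R3 → R3) : Prop :=
  ∀ ψ, IsTestFunction Ω ψ →
    ∫ x in Ω, ∑ k, partialDeriv k ψ x • A k x = - ∫ x in Ω, ψ x • F x

/-- `s` is a weak solution in `H¹(Ω, ℝ³)` of the stationary spin-diffusion equation
`-div (D₀ (∇s - ββ' (∇s · m) ⊗ m) - (β/2) jₑ ⊗ m) + γ₁ s + γ₂ s × m = 0` in `Ω`, with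
`∂ₙ s = 0` on the boundary. The homogeneous Neumann condition is expressed by admitting every test
function in `H¹(Ω, ℝ³)`. Here row `k` of `jₑ ⊗ m` is `(jₑ)ₖ m`, row `i` of `∇s` is `∂ᵢs`, and row
`i` of `(∇s · m) ⊗ m` is `(∂ᵢs · m) m`. -/
structure IsSpinAccumulation (Ω : Set R3) (D₀ : R3 → ℝ) (β β' γ₁ γ₂ : ℝ) (je m s : R3 → R3) :
    Prop where
  isH1 : IsH1 Ω s
  weak_eq : ∃ F : R3 → R3, MemLp F 2 (volume.restrict Ω) ∧
    HasWeakDiv Ω (fun k x => je x k • m x) F ∧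
    ∀ φ, IsH1 Ω φ →
      (∫ x in Ω, ∑ i, inner ℝ
          (D₀ x • (weakGrad Ω s i x - (β * β' * inner ℝ (weakGrad Ω s i x) (m x)) • m x))
          (weakGrad Ω φ i x))
        + ∫ x in Ω, inner ℝ (γ₁ • s x + γ₂ • cross (s x) (m x)) (φ x)
      = - (β / 2) * ∫ x in Ω, inner ℝ (F x) (φ x)

/-- The operator `H_s`, which maps `m` to the solution of the stationary spin-diffusion
equation. -/
def spinAccumulation (Ω : Set R3) (D₀ : R3 → ℝ) (β β' γ₁ γ₂ : ℝ) (je m : R3 → R3) : R3 → R3 :=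
  Classical.epsilon (IsSpinAccumulation Ω D₀ β β' γ₁ γ₂ je m)

end

/-! For a fixed `m` the problem is linear and Lax–Milgram applies. Since |m| = 1 and 0 < ββ' < 1,
the flux satisfies D₀(|∇s|² − ββ' ∑ᵢ (∂ᵢs·m)²) ≥ γ(1 − ββ')|∇s|², and (s × m)·s = 0, so the form is
coercive on H¹ with constant min(γ₁, γ(1 − ββ')). H¹ is realised as a closed subspace of L², the
graph of the weak gradient (`gradGraph`). The datum is in L² by the product rule div(jₑ ⊗ m) = (div
jₑ) m + ∑ₖ (jₑ)ₖ ∂ₖm, as jₑ and m are bounded (`IsH1.exists_hasWeakDiv_smul`).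

For the estimate put w = m₁ − m₂ and φ = s₁ − s₂, and test the form with coefficients m₂ on φ itself
(`IsSpinAccumulation.energy_sub_le`). Two errors remain. The change of coefficients acts on s₁ alone
and is bounded pointwise by the suprema of s₁ and ∇s₁ (`abs_spinDensity_sub_le`). The other error is
∫ div(jₑ ⊗ w)·φ, where only sup |jₑ| may enter. Its derivative must therefore be moved off jₑ, and
this leaves a boundary term, formally ∫ (jₑ·n) w·φ over ∂Ω, to be bounded by the H¹ norms of w and
φ.

That bound, `IsBoundedLipschitzDomain.exists_hasDivBound`, is obtained without traces. Near a
boundary point Ω is an epigraph in a direction ν, and there are cutoffs η, vanishing near ∂Ω and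
tending to 1, with |∂ᵥη| ≤ L|v| ∂_νη. The boundary term becomes an integral of ∇η, hence is
dominated by ∫ χ ∂_νη (|w|² + |φ|²). Integrating ∂_ν(χη)|u|² by parts bounds such integrals by the
H¹ norm, uniformly in η (`IsLocalCutoff.integral_weight_le`). A partition of unity makes the bound
global.

All these arguments rest on one integration by parts, `HasWeakDiv.integral_inner`, for an L² field
with L² divergence against a compactly supported H¹ function. Products are bounded in Young's form
tE(w) + E(φ)/t with a free t > 0, chosen only at the end. -/

/-! ### Calculus of test functions. -/

section TestFunctions

variable {Ω : Set R3} {ψ χ : R3 → ℝ}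

lemma IsTestFunction.eq_zero_of_notMem (hψ : IsTestFunction Ω ψ) {x : R3} (hx : x ∉ Ω) :
    ψ x = 0 :=
  image_eq_zero_of_notMem_tsupport fun h => hx (hψ.support_subset h)

lemma tsupport_partialDeriv_subset (i : Fin 3) (ψ : R3 → ℝ) :
    tsupport (partialDeriv i ψ) ⊆ tsupport ψ :=
  tsupport_fderiv_apply_subset ℝ _

lemma IsTestFunction.differentiable (hψ : IsTestFunction Ω ψ) : Differentiable ℝ ψ :=
  hψ.smooth.differentiable (by simp)

lemma contDiff_partialDeriv (hψ : ContDiff ℝ ((⊤ : ℕ∞) : WithTop ℕ∞) ψ) (i : Fin 3) :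
    ContDiff ℝ ((⊤ : ℕ∞) : WithTop ℕ∞) (partialDeriv i ψ) :=
  (hψ.fderiv_right (m := ((⊤ : ℕ∞) : WithTop ℕ∞)) (by simp)).clm_apply contDiff_const

lemma IsTestFunction.partialDeriv (hψ : IsTestFunction Ω ψ) (i : Fin 3) :
    IsTestFunction Ω (partialDeriv i ψ) where
  smooth := contDiff_partialDeriv hψ.smooth i
  compactSupport := hψ.compactSupport.mono' <|
    (subset_tsupport _).trans (tsupport_partialDeriv_subset i ψ)
  support_subset := (tsupport_partialDeriv_subset i ψ).trans hψ.support_subset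

lemma IsTestFunction.continuous (hψ : IsTestFunction Ω ψ) : Continuous ψ :=
  hψ.smooth.continuous

lemma IsTestFunction.exists_bound (hψ : IsTestFunction Ω ψ) : ∃ C, ∀ x, ‖ψ x‖ ≤ C :=
  hψ.compactSupport.exists_bound_of_continuous hψ.continuous

lemma partialDeriv_mul (hψ : Differentiable ℝ ψ) (hχ : Differentiable ℝ χ) (i : Fin 3) (x : R3) :
    partialDeriv i (fun y => ψ y * χ y) x
      = ψ x * partialDeriv i χ x + χ x * partialDeriv i ψ x := by
  simp [partialDeriv, fderiv_fun_mul (hψ x) (hχ x)]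

lemma partialDeriv_comp_sub_const (i : Fin 3) (ρ : R3 → ℝ) (y x : R3) :
    partialDeriv i (fun x => ρ (x - y)) x = partialDeriv i ρ (x - y) := by
  simp only [partialDeriv, sub_eq_add_neg, fderiv_comp_add_right]

lemma partialDeriv_comp_const_sub (i : Fin 3) {ρ : R3 → ℝ} (hρ : Differentiable ℝ ρ) (x y : R3) :
    partialDeriv i (fun y => ρ (x - y)) y = - partialDeriv i ρ (x - y) := by
  have h := (hρ (x - y)).hasFDerivAt.comp y ((hasFDerivAt_id y).const_sub x)
  simp only [partialDeriv]
  rw [show (fun y => ρ (x - y)) = ρ ∘ HSub.hSub x from rfl, h.fderiv]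
  simp

end TestFunctions

/-! ### Integrability of products. -/

section Integrability

variable {α : Type*} [MeasurableSpace α] {μ : Measure α} {E : Type*} [NormedAddCommGroup E]
  [InnerProductSpace ℝ E] {p : ℝ≥0∞}

lemma MeasureTheory.MemLp.integrable_inner_two {f g : α → E} (hf : MemLp f 2 μ)
    (hg : MemLp g 2 μ) : Integrable (fun x => inner ℝ (f x) (g x)) μ := by
  refine (hf.norm.integrable_mul hg.norm).mono'
    (hf.aestronglyMeasurable.inner hg.aestronglyMeasurable) (.of_forall fun x => ?_)
  exact norm_inner_le_norm _ _

lemma MeasureTheory.MemLp.bounded_smul {f : α → E} (hf : MemLp f p μ) {ψ : α → ℝ}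
    (hψ : AEStronglyMeasurable ψ μ) {C : ℝ} (hC : ∀ᵐ x ∂μ, ‖ψ x‖ ≤ C) :
    MemLp (fun x => ψ x • f x) p μ := by
  refine hf.of_le_mul (c := C) (hψ.smul hf.aestronglyMeasurable) ?_
  filter_upwards [hC] with x hx
  rw [norm_smul]
  gcongr

lemma IsTestFunction.memLp_smul {Ω : Set R3} {ψ : R3 → ℝ} (hψ : IsTestFunction Ω ψ)
    {μ : Measure R3} {f : R3 → E} (hf : MemLp f p μ) : MemLp (fun x => ψ x • f x) p μ :=
  let ⟨_, hC⟩ := hψ.exists_bound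
  hf.bounded_smul hψ.continuous.aestronglyMeasurable (.of_forall hC)

end Integrability

/-! ### Correlation of two fields and its mollification. -/

section Correlation

variable {f g : R3 → R3} {ρ : R3 → ℝ}

/-- Translations act continuously on L². This continuity later allows an identity known only for
almost every small shift to be evaluated at shift zero. -/
lemma continuous_integral_inner_comp_sub (hf : MemLp f 2 volume) (hg : MemLp g 2 volume) :
    Continuous fun z => ∫ x, inner ℝ (f x) (g (x - z)) := by
  let T : R3 → C(R3, R3) := fun z => ⟨fun x => x - z, by fun_prop⟩
  have hT : Continuous T :=
    ContinuousMap.continuous_of_continuous_uncurry T <|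
      show Continuous fun p : R3 × R3 => p.2 - p.1 by fun_prop
  have hTm : ∀ z, MeasurePreserving (T z) volume volume := fun z =>
    measurePreserving_sub_right volume z
  have hc : Continuous fun z => Lp.compMeasurePreserving (T z) (hTm z) (hg.toLp g) :=
    continuous_const.compMeasurePreservingLp hT hTm (by simp)
  have key : ∀ z, ∫ x, inner ℝ (f x) (g (x - z))
      = inner ℝ (hf.toLp f) (Lp.compMeasurePreserving (T z) (hTm z) (hg.toLp g)) := by
    intro z
    rw [L2.inner_def]
    refine integral_congr_ae ?_
    filter_upwards [hf.coeFn_toLp, Lp.coeFn_compMeasurePreserving (hg.toLp g) (hTm z),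
      (hTm z).quasiMeasurePreserving.ae_eq_comp hg.coeFn_toLp] with x h1 h2 h3
    rw [h1, h2, h3]
    rfl
  simp only [key]
  exact continuous_const.inner hc

lemma integrable_mul_inner_prod (hf : Integrable f) (hg : Integrable g) (hρ : Continuous ρ)
    {C : ℝ} (hC : ∀ x, ‖ρ x‖ ≤ C) :
    Integrable (fun p : R3 × R3 => ρ (p.1 - p.2) * inner ℝ (f p.1) (g p.2))
      ((volume : Measure R3).prod volume) := by
  refine Integrable.bdd_mul (c := C) ?_ (by fun_prop) (.of_forall fun _ => hC _)
  exact hf.op_fst_snd (F := R3) (G := ℝ) (op := fun a b : R3 => (inner ℝ a b : ℝ))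
    (by fun_prop)
    ⟨1, fun x y => by simpa using norm_inner_le_norm (𝕜 := ℝ) x y⟩ hg

lemma integral_inner_integral_left (hf : Integrable f) (hg : Integrable g) (hρ : Continuous ρ)
    {C : ℝ} (hC : ∀ x, ‖ρ x‖ ≤ C) :
    ∫ x, ∫ y, ρ (x - y) * inner ℝ (f x) (g y)
      = ∫ y, inner ℝ (∫ x, ρ (x - y) • f x) (g y) := by
  rw [integral_integral_swap (integrable_mul_inner_prod hf hg hρ hC)]
  congr 1 with y
  rw [real_inner_comm, ← integral_inner]
  · simp [inner_smul_right, real_inner_comm]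
  · exact hf.bdd_smul C (by fun_prop) (.of_forall fun _ => hC _)

lemma integral_inner_integral_right (hg : Integrable g) (hρ : Continuous ρ)
    {C : ℝ} (hC : ∀ x, ‖ρ x‖ ≤ C) :
    ∫ x, ∫ y, ρ (x - y) * inner ℝ (f x) (g y)
      = ∫ x, inner ℝ (f x) (∫ y, ρ (x - y) • g y) := by
  congr 1 with x
  rw [← integral_inner]
  · simp [inner_smul_right]
  · exact hg.bdd_smul C (by fun_prop) (.of_forall fun _ => hC _)

/-- Fubini and the substitution z = x − y. The symmetric double integral can then be read as a
mollification of f or of g, so that a derivative of ρ can be passed from one to the other. -/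
lemma integral_smul_integral_inner_comp_sub (hf : Integrable f) (hg : Integrable g)
    (hρ : Continuous ρ) {C : ℝ} (hC : ∀ x, ‖ρ x‖ ≤ C) :
    ∫ z, ρ z • ∫ x, inner ℝ (f x) (g (x - z))
      = ∫ x, ∫ y, ρ (x - y) * inner ℝ (f x) (g y) := by
  have hg' : Integrable (fun y => g (-y)) := hg.comp_neg
  have h1 : Integrable (fun p : R3 × R3 => (inner ℝ (f p.2) (g (-(p.1 - p.2))) : ℝ))
      ((volume : Measure R3).prod volume) := hf.convolution_integrand (innerSL ℝ) hg'
  have h2 : Integrable (fun p : R3 × R3 => ρ p.1 * inner ℝ (f p.2) (g (p.2 - p.1)))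
      ((volume : Measure R3).prod volume) := by
    refine Integrable.bdd_mul (c := C) ?_ (by fun_prop) (.of_forall fun _ => hC _)
    simpa using h1
  simp only [smul_eq_mul, ← integral_const_mul]
  rw [integral_integral_swap h2]
  congr 1 with x
  rw [← integral_sub_left_eq_self (fun y => ρ (x - y) * inner ℝ (f x) (g y)) volume x]
  simp

end Correlation

/-! ### Integration by parts for L² fields with L² divergence. -/

section IntegrationByParts

variable {Ω : Set R3} {ψ ρ : R3 → ℝ} {u F : R3 → R3} {G A : Fin 3 → R3 → R3}

lemma IsTestFunction.memLp_smul_volume {p : ℝ≥0∞} (hΩ : MeasurableSet Ω) (hψ : IsTestFunction Ω ψ)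
    (hu : MemLp u p (volume.restrict Ω)) : MemLp (fun x => ψ x • u x) p volume := by
  have h0 : MemLp (fun x => ψ x • u x) p (volume.restrict Ω) := hψ.memLp_smul hu
  have h := (memLp_indicator_iff_restrict hΩ).2 h0
  rwa [Set.indicator_eq_self.2] at h
  intro x hx
  by_contra hxΩ
  simp [hψ.eq_zero_of_notMem hxΩ] at hx

lemma IsTestFunction.integral_smul_eq_setIntegral (hψ : IsTestFunction Ω ψ) (v : R3 → R3) :
    ∫ x, ψ x • v x = ∫ x in Ω, ψ x • v x :=
  (setIntegral_eq_integral_of_forall_compl_eq_zero fun x hx => by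
    simp [hψ.eq_zero_of_notMem hx]).symm

lemma IsTestFunction.mul (hψ : IsTestFunction Ω ψ)
    (hρ : ContDiff ℝ ((⊤ : ℕ∞) : WithTop ℕ∞) ρ) : IsTestFunction Ω (fun y => ρ y * ψ y) where
  smooth := hρ.mul hψ.smooth
  compactSupport := hψ.compactSupport.mul_left
  support_subset := (tsupport_mul_subset_right).trans hψ.support_subset

/-- Leibniz rule for the product of a test function and a weakly differentiable function, tested
against translates of a mollifier. -/
lemma IsL2WeakGrad.integral_mollifier_smul (hΩ : MeasurableSet Ω)
    (hfin : volume Ω ≠ ∞) (hu : MemLp u 2 (volume.restrict Ω))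
    (hG : IsL2WeakGrad Ω u G) (hψ : IsTestFunction Ω ψ) (hρ : IsTestFunction Set.univ ρ)
    (k : Fin 3) (x : R3) :
    ∫ y, ρ (x - y) • (partialDeriv k ψ y • u y + ψ y • G k y)
      = ∫ y, partialDeriv k ρ (x - y) • ψ y • u y := by
  have : IsFiniteMeasure (volume.restrict Ω) := ⟨by simpa using hfin.lt_top⟩
  have hρx : ContDiff ℝ ((⊤ : ℕ∞) : WithTop ℕ∞) (fun y => ρ (x - y)) :=
    hρ.smooth.comp (contDiff_const.sub contDiff_id)
  have hρx' : ContDiff ℝ ((⊤ : ℕ∞) : WithTop ℕ∞) (fun y => partialDeriv k ρ (x - y)) :=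
    (contDiff_partialDeriv hρ.smooth k).comp (contDiff_const.sub contDiff_id)
  have h1 := hψ.mul hρx
  have h2 := (hψ.partialDeriv k).mul hρx
  have h3 := hψ.mul hρx'
  have hint : ∀ {θ : R3 → ℝ} {v : R3 → R3}, IsTestFunction Ω θ → MemLp v 2 (volume.restrict Ω) →
      Integrable (fun y => θ y • v y) :=
    fun hθ hv => memLp_one_iff_integrable.1
      (hθ.memLp_smul_volume hΩ (hv.mono_exponent (by norm_num)))
  have key := hG.integral_eq _ h1 k
  have hd : ∀ y, partialDeriv k (fun y => ρ (x - y) * ψ y) y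
      = ρ (x - y) * partialDeriv k ψ y - partialDeriv k ρ (x - y) * ψ y := by
    intro y
    rw [partialDeriv_mul (hρx.differentiable (by simp)) hψ.differentiable,
      partialDeriv_comp_const_sub k hρ.differentiable]
    ring
  rw [← (h1.partialDeriv k).integral_smul_eq_setIntegral, ← h1.integral_smul_eq_setIntegral] at key
  simp only [hd, sub_smul] at key
  rw [integral_sub (hint h2 hu) (hint h3 hu)] at key
  simp only [smul_add, smul_smul]
  rw [integral_add (hint h2 hu) (hint h1 (hG.memLp k))]
  rw [← sub_eq_zero] at key ⊢
  rw [← key]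
  abel

/-- The translate ρ(· − y) is itself a test function in Ω when its support stays in Ω, so the
definition of the weak divergence applies to it. -/
lemma HasWeakDiv.integral_mollifier_smul (hΩ : MeasurableSet Ω)
    (hdiv : HasWeakDiv Ω A F) (hρ : IsTestFunction Set.univ ρ) {y : R3}
    (hy : ∀ x, x - y ∈ tsupport ρ → x ∈ Ω) :
    ∫ x, ∑ k, partialDeriv k ρ (x - y) • Ω.indicator (A k) x
      = - ∫ x, ρ (x - y) • Ω.indicator F x := by
  have ht : IsTestFunction Ω (fun x => ρ (x - y)) := by
    refine ⟨hρ.smooth.comp (contDiff_id.sub contDiff_const),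
      hρ.compactSupport.comp_homeomorph (Homeomorph.subRight y), fun x hx => hy x ?_⟩
    have := tsupport_comp_eq_preimage ρ (Homeomorph.subRight y)
    exact (this ▸ hx : x ∈ Homeomorph.subRight y ⁻¹' tsupport ρ)
  have key := hdiv _ ht
  simp only [partialDeriv_comp_sub_const] at key
  rw [← integral_indicator hΩ, ← integral_indicator hΩ] at key
  refine (integral_congr_ae (.of_forall fun x => ?_)).trans
    (key.trans (congrArg Neg.neg (integral_congr_ae (.of_forall fun x => ?_))))
  all_goals by_cases hx : x ∈ Ω <;> simp [hx]

/-- Integration by parts in `Ω` for a field with a weak divergence and a localized function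
of class `H¹`. -/
theorem HasWeakDiv.integral_inner (hΩ : IsOpen Ω) (hfin : volume Ω ≠ ∞)
    (hdiv : HasWeakDiv Ω A F) (hA : ∀ k, MemLp (A k) 2 (volume.restrict Ω))
    (hF : MemLp F 2 (volume.restrict Ω)) (hu : MemLp u 2 (volume.restrict Ω))
    (hG : IsL2WeakGrad Ω u G) (hψ : IsTestFunction Ω ψ) :
    ∫ x in Ω, ψ x * inner ℝ (F x) (u x)
      = - ∫ x in Ω, ∑ k, (partialDeriv k ψ x * inner ℝ (A k x) (u x)
          + ψ x * inner ℝ (A k x) (G k x)) := by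
  have hΩm := hΩ.measurableSet
  have : IsFiniteMeasure (volume.restrict Ω) := ⟨by simpa using hfin.lt_top⟩
  have hind : ∀ {p : ℝ≥0∞} {v : R3 → R3}, MemLp v p (volume.restrict Ω) →
      MemLp (Ω.indicator v) p volume := fun h => (memLp_indicator_iff_restrict hΩm).2 h
  have hL1 : ∀ {v : R3 → R3}, MemLp v 2 (volume.restrict Ω) → MemLp v 1 (volume.restrict Ω) :=
    fun h => h.mono_exponent (by norm_num)
  set f := Ω.indicator F with hf
  set fA : Fin 3 → R3 → R3 := fun k => Ω.indicator (A k) with hfA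
  set g : R3 → R3 := fun x => ψ x • u x with hg
  set h : Fin 3 → R3 → R3 := fun k x => partialDeriv k ψ x • u x + ψ x • G k x with hh
  have f2 : MemLp f 2 volume := hind hF
  have f1 : Integrable f := memLp_one_iff_integrable.1 (hind (hL1 hF))
  have fA2 : ∀ k, MemLp (fA k) 2 volume := fun k => hind (hA k)
  have fA1 : ∀ k, Integrable (fA k) := fun k => memLp_one_iff_integrable.1 (hind (hL1 (hA k)))
  have g2 : MemLp g 2 volume := hψ.memLp_smul_volume hΩm hu
  have g1 : Integrable g := memLp_one_iff_integrable.1 (hψ.memLp_smul_volume hΩm (hL1 hu))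
  have h2 : ∀ k, MemLp (h k) 2 volume := fun k =>
    ((hψ.partialDeriv k).memLp_smul_volume hΩm hu).add (hψ.memLp_smul_volume hΩm (hG.memLp k))
  have h1 : ∀ k, Integrable (h k) := fun k => memLp_one_iff_integrable.1 <|
    ((hψ.partialDeriv k).memLp_smul_volume hΩm (hL1 hu)).add
      (hψ.memLp_smul_volume hΩm (hL1 (hG.memLp k)))
  -- The defect of the formula when g = ψu and its weak gradient h are shifted by z. The claim is
  -- c(0) = 0; as c is continuous, it suffices that c vanishes as a distribution near 0.
  let c : R3 → ℝ := fun z =>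
    (∫ x, inner ℝ (f x) (g (x - z))) + ∑ k, ∫ x, inner ℝ (fA k x) (h k (x - z))
  have hc : Continuous c :=
    (continuous_integral_inner_comp_sub f2 g2).add
      (continuous_finsetSum _ fun k _ => continuous_integral_inner_comp_sub (fA2 k) (h2 k))
  -- For |z| < δ the support of ψ, shifted by z, stays in Ω; only such shifts are tested.
  obtain ⟨δ, hδ, hδΩ⟩ := hψ.compactSupport.isCompact.exists_thickening_subset_open hΩ
    hψ.support_subset
  have hzero : ∀ ρ : R3 → ℝ, IsTestFunction (Metric.ball 0 δ) ρ → ∫ z, ρ z • c z = 0 := by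
    intro ρ hρ'
    have hρ : IsTestFunction Set.univ ρ := ⟨hρ'.smooth, hρ'.compactSupport, Set.subset_univ _⟩
    obtain ⟨C, hC⟩ := hρ.exists_bound
    choose C' hC' using fun k => (hρ.partialDeriv k).exists_bound
    have hρc : ∀ {v : R3 → ℝ}, Continuous v → Integrable fun z => ρ z * v z := fun hv =>
      (hρ.continuous.mul hv).integrable_of_hasCompactSupport hρ.compactSupport.mul_right
    have e1 : ∫ z, ρ z • c z = (∫ y, inner ℝ (∫ x, ρ (x - y) • f x) (g y))
        + ∑ k, ∫ y, inner ℝ (∫ x, partialDeriv k ρ (x - y) • fA k x) (g y) := by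
      simp only [c, smul_eq_mul, mul_add, Finset.mul_sum]
      rw [integral_add (hρc (continuous_integral_inner_comp_sub f2 g2))
        (integrable_finsetSum _ fun k _ =>
          hρc (continuous_integral_inner_comp_sub (fA2 k) (h2 k))),
        integral_finsetSum _ fun k _ => hρc (continuous_integral_inner_comp_sub (fA2 k) (h2 k))]
      congr 1
      · rw [← integral_inner_integral_left f1 g1 hρ.continuous hC]
        exact integral_smul_integral_inner_comp_sub f1 g1 hρ.continuous hC
      · refine Finset.sum_congr rfl fun k _ => ?_
        rw [← integral_inner_integral_left (fA1 k) g1 (hρ.partialDeriv k).continuous (hC' k),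
          integral_inner_integral_right g1 (hρ.partialDeriv k).continuous (hC' k)]
        simp only [hg]
        -- The mollification of h with ρ equals that of g with ∂ₖρ. Thus every derivative falls on
        -- ρ, ready for the weak divergence of A.
        simp only [← hG.integral_mollifier_smul hΩm hfin hu hψ hρ k]
        rw [← integral_inner_integral_right (h1 k) hρ.continuous hC]
        exact integral_smul_integral_inner_comp_sub (fA1 k) (h1 k) hρ.continuous hC
    have iA : ∀ k y, Integrable fun x => partialDeriv k ρ (x - y) • fA k x := fun k y =>
      (fA1 k).bdd_smul (C' k)
        ((hρ.partialDeriv k).continuous.comp (by fun_prop)).aestronglyMeasurable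
        (.of_forall fun _ => hC' k _)
    have iI : ∀ {θ : R3 → ℝ} {v : R3 → R3} {C : ℝ}, IsTestFunction Set.univ θ →
        (∀ x, ‖θ x‖ ≤ C) → Integrable v →
        Integrable fun y => (inner ℝ (∫ x, θ (x - y) • v x) (g y) : ℝ) := by
      intro θ v C hθ hCθ hv
      refine (integrable_mul_inner_prod hv g1 hθ.continuous hCθ).integral_prod_right.congr
        (.of_forall fun y => ?_)
      simp only []
      have hi : Integrable fun x => θ (x - y) • v x :=
        hv.bdd_smul C (hθ.continuous.comp (by fun_prop)).aestronglyMeasurable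
          (.of_forall fun _ => hCθ _)
      rw [real_inner_comm, ← _root_.integral_inner hi (g y)]
      simp [inner_smul_right, real_inner_comm]
    rw [e1, ← integral_finsetSum _ fun k _ => iI (hρ.partialDeriv k) (hC' k) (fA1 k),
      ← integral_add (iI hρ hC f1)
        (integrable_finsetSum _ fun k _ => iI (hρ.partialDeriv k) (hC' k) (fA1 k))]
    refine integral_eq_zero_of_ae (.of_forall fun y => ?_)
    simp only [Pi.zero_apply]
    -- On the support of ψ the two mollified terms cancel by the weak divergence; off it g vanishes.
    by_cases hy : y ∈ tsupport ψ
    · have key := hdiv.integral_mollifier_smul hΩm hρ (y := y) fun x hx => hδΩ <|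
        Metric.mem_thickening_iff.2 ⟨y, hy, by
          simpa [dist_eq_norm] using hρ'.support_subset hx⟩
      rw [integral_finsetSum _ fun k _ => iA k y] at key
      rw [← sum_inner, key, inner_neg_left]
      exact add_neg_cancel _
    · simp [hg, image_eq_zero_of_notMem_tsupport hy]
  have hc0 : c 0 = 0 := by
    have hball : IsOpen (Metric.ball (0 : R3) δ) := Metric.isOpen_ball
    have hae := hball.ae_eq_zero_of_integral_contDiff_smul_eq_zero (μ := volume)
      (hc.locallyIntegrable.locallyIntegrableOn _)
      fun ρ h1 h2 h3 => hzero ρ ⟨h1, h2, h3⟩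
    have := Measure.eqOn_open_of_ae_eq (μ := (volume : Measure R3)) (f := c) (g := fun _ => 0)
      (U := Metric.ball 0 δ)
      ((ae_restrict_iff' measurableSet_ball).2 hae) Metric.isOpen_ball hc.continuousOn
      continuousOn_const
    exact this (Metric.mem_ball_self hδ)
  have q1 : ∫ x in Ω, ψ x * inner ℝ (F x) (u x) = ∫ x, inner ℝ (f x) (g (x - 0)) := by
    rw [← integral_indicator hΩm]
    congr 1 with x
    by_cases hx : x ∈ Ω <;> simp [hx, hf, hg, inner_smul_right]
  have q2 : ∀ k, ∫ x in Ω, (partialDeriv k ψ x * inner ℝ (A k x) (u x)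
      + ψ x * inner ℝ (A k x) (G k x)) = ∫ x, inner ℝ (fA k x) (h k (x - 0)) := by
    intro k
    rw [← integral_indicator hΩm]
    congr 1 with x
    by_cases hx : x ∈ Ω <;> simp [hx, hfA, hh, inner_smul_right, inner_add_right]
  have iF : ∀ k, Integrable (fun x => partialDeriv k ψ x * inner ℝ (A k x) (u x)
      + ψ x * inner ℝ (A k x) (G k x)) (volume.restrict Ω) := by
    intro k
    obtain ⟨C, hC⟩ := hψ.exists_bound
    obtain ⟨C', hC'⟩ := (hψ.partialDeriv k).exists_bound
    exact (((hA k).integrable_inner_two hu).bdd_mul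
        (hψ.partialDeriv k).continuous.aestronglyMeasurable (.of_forall hC')).add
      (((hA k).integrable_inner_two (hG.memLp k)).bdd_mul
        hψ.continuous.aestronglyMeasurable (.of_forall hC))
  rw [integral_finsetSum _ fun k _ => iF k, q1]
  simp only [q2]
  exact eq_neg_of_add_eq_zero_left hc0

end IntegrationByParts

/-! ### Almost everywhere uniqueness and linearity of weak derivatives. -/

section Uniqueness

variable {Ω : Set R3} {u v f g F F' : R3 → R3} {G G' A A' : Fin 3 → R3 → R3}

lemma IsTestFunction.integrable_smul (hfin : volume Ω ≠ ∞) {ψ : R3 → ℝ} (hψ : IsTestFunction Ω ψ)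
    (hu : MemLp u 2 (volume.restrict Ω)) :
    Integrable (fun x => ψ x • u x) (volume.restrict Ω) := by
  have : IsFiniteMeasure (volume.restrict Ω) := ⟨by simpa using hfin.lt_top⟩
  exact memLp_one_iff_integrable.1 (hψ.memLp_smul (hu.mono_exponent (by norm_num)))

/-- The fundamental lemma of the calculus of variations, applied to f − g. It gives uniqueness
almost everywhere of weak gradients and divergences, so the choice made in `weakGrad` is harmless.
-/
lemma ae_eq_of_integral_test_eq (hΩ : IsOpen Ω) (hfin : volume Ω ≠ ∞)
    (hf : MemLp f 2 (volume.restrict Ω)) (hg : MemLp g 2 (volume.restrict Ω))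
    (h : ∀ ψ, IsTestFunction Ω ψ → ∫ x in Ω, ψ x • f x = ∫ x in Ω, ψ x • g x) :
    f =ᵐ[volume.restrict Ω] g := by
  have : IsFiniteMeasure (volume.restrict Ω) := ⟨by simpa using hfin.lt_top⟩
  have hfg : IntegrableOn (fun x => f x - g x) Ω :=
    memLp_one_iff_integrable.1 ((hf.sub hg).mono_exponent (by norm_num))
  have key := hΩ.ae_eq_zero_of_integral_contDiff_smul_eq_zero hfg.locallyIntegrableOn
    (fun ψ h1 h2 h3 => by
      have hψ : IsTestFunction Ω ψ := ⟨h1, h2, h3⟩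
      rw [hψ.integral_smul_eq_setIntegral]
      simp only [smul_sub]
      rw [integral_sub (hψ.integrable_smul hfin hf) (hψ.integrable_smul hfin hg), h ψ hψ, sub_self])
  filter_upwards [(ae_restrict_iff' hΩ.measurableSet).2 key] with x hx
  exact sub_eq_zero.1 hx

lemma IsL2WeakGrad.ae_eq (hΩ : IsOpen Ω) (hfin : volume Ω ≠ ∞) (hG : IsL2WeakGrad Ω u G)
    (hG' : IsL2WeakGrad Ω v G') (huv : u =ᵐ[volume.restrict Ω] v) (i : Fin 3) :
    G i =ᵐ[volume.restrict Ω] G' i := by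
  refine ae_eq_of_integral_test_eq hΩ hfin (hG.memLp i) (hG'.memLp i) fun ψ hψ => ?_
  have h1 := hG.integral_eq ψ hψ i
  have h2 := hG'.integral_eq ψ hψ i
  have h3 : ∫ x in Ω, partialDeriv i ψ x • u x = ∫ x in Ω, partialDeriv i ψ x • v x :=
    integral_congr_ae (by filter_upwards [huv] with x hx; rw [hx])
  rw [h1, h2] at h3
  exact neg_injective h3

lemma HasWeakDiv.congr (hF : HasWeakDiv Ω A F)
    (hA : ∀ k, A k =ᵐ[volume.restrict Ω] A' k) : HasWeakDiv Ω A' F := by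
  intro ψ hψ
  rw [← hF ψ hψ]
  refine integral_congr_ae ?_
  filter_upwards [ae_all_iff.2 hA] with x hx
  simp [hx]

lemma HasWeakDiv.ae_eq (hΩ : IsOpen Ω) (hfin : volume Ω ≠ ∞) (hF : HasWeakDiv Ω A F)
    (hF' : HasWeakDiv Ω A F') (h2 : MemLp F 2 (volume.restrict Ω))
    (h2' : MemLp F' 2 (volume.restrict Ω)) : F =ᵐ[volume.restrict Ω] F' :=
  ae_eq_of_integral_test_eq hΩ hfin h2 h2' fun ψ hψ => neg_injective <| by
    rw [← hF ψ hψ, ← hF' ψ hψ]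

lemma HasWeakDiv.sub (hfin : volume Ω ≠ ∞) (hF : HasWeakDiv Ω A F) (hF' : HasWeakDiv Ω A' F')
    (hA : ∀ k, MemLp (A k) 2 (volume.restrict Ω)) (hA' : ∀ k, MemLp (A' k) 2 (volume.restrict Ω))
    (h2 : MemLp F 2 (volume.restrict Ω)) (h2' : MemLp F' 2 (volume.restrict Ω)) :
    HasWeakDiv Ω (fun k x => A k x - A' k x) (fun x => F x - F' x) := by
  intro ψ hψ
  simp only [smul_sub, Finset.sum_sub_distrib]
  rw [integral_sub, integral_sub (hψ.integrable_smul hfin h2) (hψ.integrable_smul hfin h2'),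
    hF ψ hψ, hF' ψ hψ]
  · abel
  · exact integrable_finsetSum _ fun k _ => (hψ.partialDeriv k).integrable_smul hfin (hA k)
  · exact integrable_finsetSum _ fun k _ => (hψ.partialDeriv k).integrable_smul hfin (hA' k)

lemma IsL2WeakGrad.sub (hfin : volume Ω ≠ ∞) (hG : IsL2WeakGrad Ω u G)
    (hG' : IsL2WeakGrad Ω v G') (hu : MemLp u 2 (volume.restrict Ω))
    (hv : MemLp v 2 (volume.restrict Ω)) :
    IsL2WeakGrad Ω (u - v) (fun i => G i - G' i) where
  memLp i := (hG.memLp i).sub (hG'.memLp i)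
  integral_eq ψ hψ i := by
    simp only [smul_sub, Pi.sub_apply]
    rw [integral_sub ((hψ.partialDeriv i).integrable_smul hfin hu)
      ((hψ.partialDeriv i).integrable_smul hfin hv),
      integral_sub (hψ.integrable_smul hfin (hG.memLp i))
        (hψ.integrable_smul hfin (hG'.memLp i)), hG.integral_eq ψ hψ i, hG'.integral_eq ψ hψ i]
    abel

lemma IsH1.weakGrad_spec (hu : IsH1 Ω u) : IsL2WeakGrad Ω u (weakGrad Ω u) :=
  Classical.epsilon_spec hu.exists_grad

lemma IsH1.sub (hfin : volume Ω ≠ ∞) (hu : IsH1 Ω u) (hv : IsH1 Ω v) : IsH1 Ω (u - v) :=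
  ⟨hu.memLp.sub hv.memLp, _, hu.weakGrad_spec.sub hfin hv.weakGrad_spec hu.memLp hv.memLp⟩

lemma IsL2WeakGrad.weakGrad_ae_eq (hΩ : IsOpen Ω) (hfin : volume Ω ≠ ∞)
    (hG : IsL2WeakGrad Ω u G) (i : Fin 3) : weakGrad Ω u i =ᵐ[volume.restrict Ω] G i :=
  IsL2WeakGrad.ae_eq hΩ hfin (Classical.epsilon_spec (p := IsL2WeakGrad Ω u) ⟨G, hG⟩) hG .rfl i

lemma IsH1.weakGrad_sub (hΩ : IsOpen Ω) (hfin : volume Ω ≠ ∞) (hu : IsH1 Ω u) (hv : IsH1 Ω v)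
    (i : Fin 3) :
    weakGrad Ω (u - v) i =ᵐ[volume.restrict Ω] weakGrad Ω u i - weakGrad Ω v i :=
  (hu.weakGrad_spec.sub hfin hv.weakGrad_spec hu.memLp hv.memLp).weakGrad_ae_eq hΩ hfin i

end Uniqueness

/-! ### The divergence of `je ⊗ m` belongs to `L²`. -/

section Product

variable {Ω : Set R3} {je m : R3 → R3}

lemma MeasureTheory.AEStronglyMeasurable.euclidean_apply {μ : Measure R3}
    (h : AEStronglyMeasurable je μ) (k : Fin 3) : AEStronglyMeasurable (fun x => je x k) μ :=
  (EuclideanSpace.proj (𝕜 := ℝ) k : R3 →L[ℝ] ℝ).continuous.comp_aestronglyMeasurable h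

lemma MeasureTheory.MemLp.coord_smul {μ : Measure R3} {p : ℝ≥0∞}
    (hje : AEStronglyMeasurable je μ) {J : ℝ} (hJ : ∀ᵐ x ∂μ, ‖je x‖ ≤ J)
    (hm : MemLp m p μ) (k : Fin 3) : MemLp (fun x => je x k • m x) p μ :=
  hm.bounded_smul (hje.euclidean_apply k) (C := J) (by
    filter_upwards [hJ] with x hx
    exact (PiLp.norm_apply_le _ k).trans hx)

/-- The divergence of a vector field of class `H¹`, in a constant direction. -/
lemma IsH1.hasWeakDiv_smul_const (hfin : volume Ω ≠ ∞) (hje : IsH1 Ω je) (e : R3) :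
    HasWeakDiv Ω (fun k x => je x k • e) (fun x => (∑ k, weakGrad Ω je k x k) • e) := by
  intro ψ hψ
  have h1 : ∀ k, Integrable (fun x => partialDeriv k ψ x * je x k) (volume.restrict Ω) := fun k =>
    ((hψ.partialDeriv k).integrable_smul hfin hje.memLp).eval_piLp k
  have h2 : ∀ k, Integrable (fun x => ψ x * weakGrad Ω je k x k) (volume.restrict Ω) := fun k =>
    (hψ.integrable_smul hfin (hje.weakGrad_spec.memLp k)).eval_piLp k
  have key : ∀ k, ∫ x in Ω, partialDeriv k ψ x * je x k
      = - ∫ x in Ω, ψ x * weakGrad Ω je k x k := by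
    intro k
    have h := congrArg (fun v : R3 => v k) (hje.weakGrad_spec.integral_eq ψ hψ k)
    simp only [PiLp.neg_apply] at h
    rw [eval_integral_piLp fun i =>
        ((hψ.partialDeriv k).integrable_smul hfin hje.memLp).eval_piLp i,
      eval_integral_piLp fun i =>
        (hψ.integrable_smul hfin (hje.weakGrad_spec.memLp k)).eval_piLp i] at h
    simpa using h
  simp only [smul_smul, ← Finset.sum_smul, Finset.mul_sum]
  rw [integral_smul_const, integral_smul_const, integral_finsetSum _ fun k _ => h1 k,
    integral_finsetSum _ fun k _ => h2 k]
  simp [key]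

/-- The product rule in weak form: for each constant vector e, the field with rows (jₑ)ₖ e has
divergence (div jₑ) e, and integrating it by parts against ψm gives the component along e. -/
lemma IsH1.exists_hasWeakDiv_smul (hΩ : IsOpen Ω) (hfin : volume Ω ≠ ∞) (hje : IsH1 Ω je)
    {J M : ℝ} (hJ : ∀ᵐ x ∂(volume.restrict Ω), ‖je x‖ ≤ J) (hm : IsH1 Ω m)
    (hM : ∀ᵐ x ∂(volume.restrict Ω), ‖m x‖ ≤ M) :
    ∃ F : R3 → R3, MemLp F 2 (volume.restrict Ω) ∧ HasWeakDiv Ω (fun k x => je x k • m x) F := by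
  have hA : ∀ k, MemLp (fun x => je x k • m x) 2 (volume.restrict Ω) := fun k =>
    hm.memLp.coord_smul hje.memLp.aestronglyMeasurable hJ k
  have hB : ∀ k, MemLp (fun x => je x k • weakGrad Ω m k x) 2 (volume.restrict Ω) := fun k =>
    (hm.weakGrad_spec.memLp k).coord_smul hje.memLp.aestronglyMeasurable hJ k
  have hdiv : MemLp (fun x => ∑ k, weakGrad Ω je k x k) 2 (volume.restrict Ω) :=
    memLp_finsetSum _ fun k _ => (hje.weakGrad_spec.memLp k).eval_piLp k
  have hD : MemLp (fun x => (∑ k, weakGrad Ω je k x k) • m x) 2 (volume.restrict Ω) := by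
    refine hdiv.of_le_mul (c := M) (hdiv.aestronglyMeasurable.smul hm.memLp.aestronglyMeasurable) ?_
    filter_upwards [hM] with x hx
    rw [norm_smul, mul_comm]
    gcongr
  have hF : MemLp (fun x => (∑ k, weakGrad Ω je k x k) • m x + ∑ k, je x k • weakGrad Ω m k x) 2
      (volume.restrict Ω) := hD.add (memLp_finsetSum _ fun k _ => hB k)
  refine ⟨_, hF, fun ψ hψ => ext_inner_left ℝ fun e => ?_⟩
  have hc : ∀ c : ℝ, MemLp (fun _ : R3 => c • e) 2 (volume.restrict Ω) := fun c =>
    have : IsFiniteMeasure (volume.restrict Ω) := ⟨by simpa using hfin.lt_top⟩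
    memLp_const _
  have key := (hje.hasWeakDiv_smul_const hfin e).integral_inner hΩ hfin
    (fun k => by
      have := (hje.memLp.eval_piLp k)
      refine this.of_le_mul (c := ‖e‖)
        (this.aestronglyMeasurable.smul aestronglyMeasurable_const) (.of_forall fun x => ?_)
      rw [norm_smul, mul_comm])
    (by
      refine hdiv.of_le_mul (c := ‖e‖)
        (hdiv.aestronglyMeasurable.smul aestronglyMeasurable_const) (.of_forall fun x => ?_)
      rw [norm_smul, mul_comm])
    hm.memLp hm.weakGrad_spec hψ
  have i1 : ∀ k, Integrable (fun x => partialDeriv k ψ x • je x k • m x) (volume.restrict Ω) :=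
    fun k => (hψ.partialDeriv k).integrable_smul hfin (hA k)
  have i2 := hψ.integrable_smul hfin hF
  have i3 : Integrable (fun x => ψ x • ∑ k, je x k • weakGrad Ω m k x) (volume.restrict Ω) :=
    hψ.integrable_smul hfin (memLp_finsetSum _ fun k _ => hB k)
  have i4 := hψ.integrable_smul hfin hD
  rw [inner_neg_right, ← integral_inner (integrable_finsetSum _ fun k _ => i1 k),
    ← integral_inner i2]
  have j1 := (integrable_finsetSum Finset.univ fun k _ => i1 k).const_inner (𝕜 := ℝ) e
  have j3 := i3.const_inner (𝕜 := ℝ) e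
  have j4 := i4.const_inner (𝕜 := ℝ) e
  have e1 : ∫ x in Ω, (inner ℝ e (ψ x • ((∑ k, weakGrad Ω je k x k) • m x
      + ∑ k, je x k • weakGrad Ω m k x)) : ℝ)
      = (∫ x in Ω, ψ x * inner ℝ ((∑ k, weakGrad Ω je k x k) • e) (m x))
        + ∫ x in Ω, inner ℝ e (ψ x • ∑ k, je x k • weakGrad Ω m k x) := by
    rw [← integral_add _ j3]
    · refine integral_congr_ae (.of_forall fun x => ?_)
      simp only [smul_add, inner_add_right, inner_smul_right, inner_smul_left]
      simp
    · refine j4.congr (.of_forall fun x => ?_)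
      simp only [inner_smul_right, inner_smul_left]
      simp
  have e2 : ∫ x in Ω, ∑ k, (partialDeriv k ψ x * inner ℝ (je x k • e) (m x)
      + ψ x * inner ℝ (je x k • e) (weakGrad Ω m k x))
      = (∫ x in Ω, inner ℝ e (∑ k, partialDeriv k ψ x • je x k • m x))
        + ∫ x in Ω, inner ℝ e (ψ x • ∑ k, je x k • weakGrad Ω m k x) := by
    rw [← integral_add j1 j3]
    refine integral_congr_ae (.of_forall fun x => ?_)
    simp only [inner_smul_right, inner_smul_left, inner_sum, Finset.sum_add_distrib,
      Finset.mul_sum]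
    simp
  rw [e1, key, e2]
  ring

end Product

/-! ### The cross product. -/

section Cross

/-- Lagrange's identity: |a|²|b|² − |a × b|² is the square of a·b. -/
lemma norm_cross_le (a b : R3) : ‖cross a b‖ ≤ ‖a‖ * ‖b‖ := by
  refine le_of_sq_le_sq ?_ (by positivity)
  rw [mul_pow, EuclideanSpace.norm_sq_eq, EuclideanSpace.norm_sq_eq, EuclideanSpace.norm_sq_eq]
  simp only [cross, crossProduct, Fin.sum_univ_three, Real.norm_eq_abs, sq_abs]
  simp
  nlinarith [sq_nonneg (a 0 * b 0 + a 1 * b 1 + a 2 * b 2)]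

lemma inner_cross_self (a b : R3) : inner ℝ (cross a b) a = 0 := by
  simp only [cross, crossProduct, PiLp.inner_apply, Fin.sum_univ_three]
  simp
  ring

lemma cross_add_left (a b c : R3) : cross (a + b) c = cross a c + cross b c := by
  simp [cross]

lemma cross_smul_left (r : ℝ) (a c : R3) : cross (r • a) c = r • cross a c := by
  simp [cross]

lemma cross_sub_left (a b c : R3) : cross (a - b) c = cross a c - cross b c := by
  simp [cross]

lemma cross_sub_right (a b c : R3) : cross a (b - c) = cross a b - cross a c := by
  simp [cross]

lemma continuous_cross : Continuous fun p : R3 × R3 => cross p.1 p.2 := by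
  unfold cross
  refine (PiLp.continuous_toLp 2 _).comp ?_
  refine continuous_pi fun i => ?_
  fin_cases i <;> simp [crossProduct] <;> fun_prop

end Cross

/-! ### Cutoff functions adapted to a Lipschitz boundary. -/

section Cutoff

open Filter Topology Convolution

/-- Convolution with a probability density averages translates of g, and so preserves both the
Lipschitz constant and every translation invariance. -/
lemma LipschitzWith.exists_smooth_approx {K : ℝ≥0} {g : R3 → ℝ} (hg : LipschitzWith K g) {ε : ℝ}
    (hε : 0 < ε) :
    ∃ g' : R3 → ℝ, ContDiff ℝ ((⊤ : ℕ∞) : WithTop ℕ∞) g' ∧ LipschitzWith K g' ∧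
      (∀ y, |g' y - g y| ≤ ε) ∧ ∀ v, (∀ y, g (y + v) = g y) → ∀ y, g' (y + v) = g' y := by
  -- On a ball of this radius g varies by at most ε; the 1 allows K = 0.
  have hr : 0 < ε / (K + 1) := by positivity
  let φ : ContDiffBump (0 : R3) := ⟨ε / (K + 1) / 2, ε / (K + 1), by positivity, by linarith⟩
  have hint : ∀ x, Integrable fun t => φ.normed volume t * g (x - t) := fun x =>
    (φ.continuous_normed.mul (hg.continuous.comp (by fun_prop))).integrable_of_hasCompactSupport
      φ.hasCompactSupport_normed.mul_right
  refine ⟨φ.normed volume ⋆[ContinuousLinearMap.lsmul ℝ ℝ, volume] g, ?_, ?_, ?_, ?_⟩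
  · exact φ.hasCompactSupport_normed.contDiff_convolution_left _ φ.contDiff_normed
      hg.continuous.locallyIntegrable
  · refine LipschitzWith.of_dist_le_mul fun x y => ?_
    simp only [convolution, ContinuousLinearMap.lsmul_apply, smul_eq_mul]
    rw [dist_eq_norm, ← integral_sub (hint x) (hint y)]
    calc ‖∫ t, (φ.normed volume t * g (x - t) - φ.normed volume t * g (y - t))‖
        ≤ ∫ t, φ.normed volume t * (K * dist x y) := by
          refine norm_integral_le_of_norm_le (φ.integrable_normed.mul_const _)
            (.of_forall fun t => ?_)
          rw [← mul_sub, norm_mul, Real.norm_of_nonneg (φ.nonneg_normed t)]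
          refine mul_le_mul_of_nonneg_left ?_ (φ.nonneg_normed t)
          simpa [dist_eq_norm] using hg.dist_le_mul (x - t) (y - t)
      _ = K * dist x y := by rw [integral_mul_const, φ.integral_normed, one_mul]
  · intro y
    rw [← Real.dist_eq]
    refine φ.dist_normed_convolution_le hg.continuous.aestronglyMeasurable fun z hz => ?_
    refine (hg.dist_le_mul z y).trans ?_
    have h1 : dist z y ≤ ε / (K + 1) := (Metric.mem_ball.1 hz).le
    calc (K : ℝ) * dist z y ≤ (K + 1) * (ε / (K + 1)) := by gcongr; linarith
      _ = ε := by field_simp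
  · intro v hv y
    simp only [convolution]
    congr 1 with t
    rw [show y + v - t = y - t + v by abel, hv]

/-- Smooth cutoff functions for the epigraph of a Lipschitz function. Their gradients are controlled
by their derivatives in the direction of the epigraph. -/
lemma LipschitzWith.exists_epigraph_cutoff {K : ℝ≥0} {g : R3 → ℝ} (hg : LipschitzWith K g)
    {ν : R3} (hν : ‖ν‖ = 1) (hgν : ∀ (y : R3) (t : ℝ), g (y + t • ν) = g y) {δ : ℝ} (hδ : 0 < δ) :
    ∃ η : R3 → ℝ, ContDiff ℝ ((⊤ : ℕ∞) : WithTop ℕ∞) η ∧ (∀ y, 0 ≤ η y ∧ η y ≤ 1) ∧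
      (∀ y ∈ tsupport η, g y < inner ℝ ν y) ∧ (∀ y, g y + 3 * δ ≤ inner ℝ ν y → η y = 1) ∧
      ∀ y v, |fderiv ℝ η y v| ≤ (1 + K) * ‖v‖ * fderiv ℝ η y ν := by
  obtain ⟨g', hs, hL, hd, hinv⟩ := hg.exists_smooth_approx (half_pos hδ)
  -- The cutoff is a smooth step of f, equal to 0 for f ≤ 0 and to 1 for f ≥ 1. Since g' is within
  -- δ/2 of g, f ≥ 0 forces height at least δ/2 above the graph of g, and height 3δ forces f ≥ 1. As
  -- g' is constant along ν, ∂_νf = 1/δ, while |∂ᵥf| ≤ (1 + K)|v|/δ.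
  let f : R3 → ℝ := fun y => (inner ℝ ν y - g' y) / δ - 1
  have hf : ContDiff ℝ ((⊤ : ℕ∞) : WithTop ℕ∞) f :=
    (((contDiff_const.inner ℝ contDiff_id).sub hs).div_const δ).sub contDiff_const
  have hfd : ∀ y v, fderiv ℝ f y v = (inner ℝ ν v - fderiv ℝ g' y v) / δ := by
    intro y v
    have h1 : HasFDerivAt g' (fderiv ℝ g' y) y := (hs.differentiable (by simp) y).hasFDerivAt
    have h2 : HasFDerivAt (fun y => (inner ℝ ν y : ℝ)) (innerSL ℝ ν) y :=
      (innerSL ℝ ν).hasFDerivAt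
    have h3 : HasFDerivAt f (δ⁻¹ • (innerSL ℝ ν - fderiv ℝ g' y)) y := by
      have := ((h2.sub h1).const_mul δ⁻¹).sub_const 1
      refine this.congr_of_eventuallyEq (.of_forall fun z => ?_)
      simp [f, div_eq_inv_mul]
    rw [h3.fderiv]
    simp [div_eq_inv_mul]
  have hg'ν : ∀ y, fderiv ℝ g' y ν = 0 := by
    intro y
    have h1 : HasFDerivAt g' (fderiv ℝ g' y) y := (hs.differentiable (by simp) y).hasFDerivAt
    have h2 := h1.hasLineDerivAt ν
    have h3 : HasLineDerivAt ℝ g' 0 y ν := by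
      have : (fun t : ℝ => g' (y + t • ν)) = fun _ => g' y := by
        funext t
        exact hinv (t • ν) (fun z => hgν z t) y
      simp only [HasLineDerivAt, this]
      exact hasDerivAt_const _ _
    exact h2.unique h3
  have hηd : ∀ y v, fderiv ℝ (fun y => Real.smoothTransition (f y)) y v
      = deriv Real.smoothTransition (f y) * fderiv ℝ f y v := by
    intro y v
    have h1 : HasFDerivAt f (fderiv ℝ f y) y := (hf.differentiable (by simp) y).hasFDerivAt
    have h2 : HasDerivAt Real.smoothTransition (deriv Real.smoothTransition (f y)) (f y) :=
      ((Real.smoothTransition.contDiff (n := 1)).differentiable (by simp) _).hasDerivAt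
    rw [show (fun y => Real.smoothTransition (f y)) = Real.smoothTransition ∘ f from rfl,
      (h2.comp_hasFDerivAt y h1).fderiv]
    simp
  have hmono : ∀ t, 0 ≤ deriv Real.smoothTransition t := fun t =>
    Real.smoothTransition.monotone.deriv_nonneg
  refine ⟨fun y => Real.smoothTransition (f y), Real.smoothTransition.contDiff.comp hf,
    fun y => ⟨Real.smoothTransition.nonneg _, Real.smoothTransition.le_one _⟩, ?_, ?_, ?_⟩
  · have hcl : IsClosed {y : R3 | δ ≤ inner ℝ ν y - g' y} :=
      isClosed_le continuous_const (by have := hs.continuous; fun_prop)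
    have hsub : tsupport (fun y => Real.smoothTransition (f y))
        ⊆ {y : R3 | δ ≤ inner ℝ ν y - g' y} := by
      refine closure_minimal (fun y hy => ?_) hcl
      by_contra hlt
      refine hy (Real.smoothTransition.zero_of_nonpos ?_)
      have : inner ℝ ν y - g' y < δ := not_le.1 hlt
      have := (div_lt_one hδ).2 this
      simp only [f]
      linarith
    intro y hy
    have h1 : δ ≤ inner ℝ ν y - g' y := hsub hy
    have h2 := (abs_le.1 (hd y)).1
    linarith
  · intro y hy
    refine Real.smoothTransition.one_of_one_le ?_
    have h2 := (abs_le.1 (hd y)).2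
    have h3 : 2 ≤ (inner ℝ ν y - g' y) / δ := by
      rw [le_div_iff₀ hδ]
      linarith
    simp only [f]
    linarith
  · intro y v
    rw [hηd, hηd, hfd, hfd, hg'ν, sub_zero, real_inner_self_eq_norm_sq, hν, abs_mul,
      abs_of_nonneg (hmono _), abs_div, abs_of_pos hδ]
    have h1 : |inner ℝ ν v - fderiv ℝ g' y v| ≤ (1 + K) * ‖v‖ := by
      have h2 : |(inner ℝ ν v : ℝ)| ≤ ‖v‖ := by simpa [hν] using abs_real_inner_le_norm ν v
      have h3 : |fderiv ℝ g' y v| ≤ K * ‖v‖ :=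
        ((fderiv ℝ g' y).le_opNorm v).trans (by gcongr; exact norm_fderiv_le_of_lipschitz ℝ hL)
      calc _ ≤ _ := abs_sub _ _
        _ ≤ (1 + K) * ‖v‖ := by linarith
    have h4 := hmono (f y)
    calc deriv Real.smoothTransition (f y) * (|inner ℝ ν v - fderiv ℝ g' y v| / δ)
        ≤ deriv Real.smoothTransition (f y) * ((1 + K) * ‖v‖ / δ) := by gcongr
      _ = _ := by ring

/-- A sequence of smooth functions on the ball `B`, with values between `0` and `1` and with
supports in `Ω`, which converge to `1` in `Ω`, and whose gradients are controlled by their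
derivatives in the fixed direction `ν`. -/
structure IsCutoffSeq (Ω B : Set R3) (ν : R3) (L : ℝ) (η : ℕ → R3 → ℝ) : Prop where
  smooth : ∀ n, ContDiff ℝ ((⊤ : ℕ∞) : WithTop ℕ∞) (η n)
  nonneg : ∀ n y, 0 ≤ η n y
  le_one : ∀ n y, η n y ≤ 1
  tsupport_inter_subset : ∀ n, tsupport (η n) ∩ B ⊆ Ω
  eventually_eq_one : ∀ y ∈ Ω ∩ B, ∀ᶠ n in atTop, η n y = 1
  abs_fderiv_le : ∀ n y v, |fderiv ℝ (η n) y v| ≤ L * ‖v‖ * fderiv ℝ (η n) y ν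

/-- At a boundary point the epigraph cutoffs at scale 1/(n + 1) serve; each point strictly above the
graph is eventually at height 3/(n + 1). -/
lemma IsBoundedLipschitzDomain.exists_isCutoffSeq {Ω : Set R3} (hΩ : IsBoundedLipschitzDomain Ω)
    {x : R3} (hx : x ∈ closure Ω) :
    ∃ (r : ℝ) (ν : R3) (L : ℝ) (η : ℕ → R3 → ℝ), 0 < r ∧ ‖ν‖ ≤ 1 ∧ 0 ≤ L ∧
      IsCutoffSeq Ω (Metric.ball x r) ν L η := by
  by_cases hxΩ : x ∈ Ω
  · obtain ⟨r, hr, hball⟩ := Metric.isOpen_iff.1 hΩ.isOpen x hxΩ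
    -- An interior point needs no cutoff: η = 1, with ν = 0 and L = 0.
    exact ⟨r, 0, 0, fun _ _ => 1, hr, by simp, le_rfl, fun _ => contDiff_const,
      fun _ _ => zero_le_one, fun _ _ => le_rfl, fun _ y hy => hball hy.2,
      fun _ _ => .of_forall fun _ => rfl, fun _ _ _ => by simp⟩
  · obtain ⟨r, hr, ν, hν, K, g, hg, hgν, hloc⟩ := hΩ.lipschitz_boundary x
      ⟨hx, fun h => hxΩ (interior_subset h)⟩
    choose η h1 h2 h3 h4 h5 using fun n : ℕ =>
      hg.exists_epigraph_cutoff hν hgν (δ := 1 / ((n : ℝ) + 1)) (by positivity)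
    refine ⟨r, ν, 1 + K, η, hr, hν.le, by positivity, h1, fun n y => (h2 n y).1,
      fun n y => (h2 n y).2, fun n y hy => ?_, fun y hy => ?_, h5⟩
    · exact (hloc.ge ⟨hy.2, h3 n y hy.1⟩).1
    · have hlt : g y < inner ℝ ν y := (hloc.le hy).2
      have ht : Tendsto (fun n : ℕ => g y + 3 * (1 / ((n : ℝ) + 1))) atTop (𝓝 (g y + 3 * 0)) :=
        (tendsto_one_div_add_atTop_nhds_zero_nat.const_mul 3).const_add _
      filter_upwards [ht.eventually_lt_const (by simpa using hlt)] with n hn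
      exact h4 n y hn.le

end Cutoff

/-! ### The local estimate near the boundary. -/

section BoundaryEstimate

open Filter Topology

variable {Ω B : Set R3} {ψ χ η : R3 → ℝ} {u w φ F je : R3 → R3} {ν : R3} {L M J t : ℝ}

/-- The pointwise density of the squared `H¹` norm. -/
noncomputable def h1Density (Ω : Set R3) (u : R3 → R3) (x : R3) : ℝ :=
  ‖u x‖ ^ 2 + ∑ i, ‖weakGrad Ω u i x‖ ^ 2

/-- The squared `H¹` norm, as a real number. -/
noncomputable def h1Energy (Ω : Set R3) (u : R3 → R3) : ℝ :=
  ∫ x in Ω, h1Density Ω u x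

lemma h1Density_nonneg (Ω : Set R3) (u : R3 → R3) (x : R3) : 0 ≤ h1Density Ω u x := by
  unfold h1Density
  positivity

lemma h1Energy_nonneg (Ω : Set R3) (u : R3 → R3) : 0 ≤ h1Energy Ω u :=
  integral_nonneg fun _ => h1Density_nonneg _ _ _

lemma norm_sq_le_h1Density (Ω : Set R3) (u : R3 → R3) (x : R3) : ‖u x‖ ^ 2 ≤ h1Density Ω u x :=
  le_add_of_nonneg_right (by positivity)

lemma norm_sq_weakGrad_le_h1Density (Ω : Set R3) (u : R3 → R3) (x : R3) :
    ∑ i, ‖weakGrad Ω u i x‖ ^ 2 ≤ h1Density Ω u x :=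
  le_add_of_nonneg_left (by positivity)

lemma IsH1.integrable_norm_sq (hu : IsH1 Ω u) :
    Integrable (fun x => ‖u x‖ ^ 2) (volume.restrict Ω) :=
  hu.memLp.integrable_norm_pow (by norm_num)

lemma IsH1.integrable_h1Density (hu : IsH1 Ω u) :
    Integrable (h1Density Ω u) (volume.restrict Ω) :=
  hu.integrable_norm_sq.add <| integrable_finsetSum _ fun i _ =>
    (hu.weakGrad_spec.memLp i).integrable_norm_pow (by norm_num)

lemma fderiv_apply_eq_sum (ψ : R3 → ℝ) (x v : R3) :
    fderiv ℝ ψ x v = ∑ k, v k * partialDeriv k ψ x := by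
  conv_lhs => rw [← (EuclideanSpace.basisFun (Fin 3) ℝ).sum_repr v]
  simp [partialDeriv]

lemma fderiv_mul_apply (hχ : Differentiable ℝ χ) (hη : Differentiable ℝ η) (x v : R3) :
    fderiv ℝ (fun y => χ y * η y) x v = χ x * fderiv ℝ η x v + η x * fderiv ℝ χ x v := by
  simp [fderiv_fun_mul (hχ x) (hη x)]

lemma IsH1.hasWeakDiv_const_smul (hfin : volume Ω ≠ ∞) (hu : IsH1 Ω u) (ν : R3) :
    HasWeakDiv Ω (fun k x => ν k • u x) (fun x => ∑ k, ν k • weakGrad Ω u k x) := by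
  intro ψ hψ
  have h1 : ∀ k, Integrable (fun x => ν k • partialDeriv k ψ x • u x) (volume.restrict Ω) :=
    fun k => ((hψ.partialDeriv k).integrable_smul hfin hu.memLp).smul (ν k)
  have h2 : ∀ k, Integrable (fun x => ν k • ψ x • weakGrad Ω u k x) (volume.restrict Ω) :=
    fun k => (hψ.integrable_smul hfin (hu.weakGrad_spec.memLp k)).smul (ν k)
  simp only [Finset.smul_sum, smul_comm (partialDeriv _ ψ _), smul_comm (ψ _)]
  rw [integral_finsetSum _ fun k _ => h1 k, integral_finsetSum _ fun k _ => h2 k]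
  simp only [integral_smul, hu.weakGrad_spec.integral_eq ψ hψ]
  simp

/-- Take v = ν: a negative ∂_νη would make the left side positive and the right side nonpositive.
This makes χ ∂_νη a nonnegative weight. -/
lemma fderiv_nonneg_of_abs_le (h : ∀ v, |fderiv ℝ η x v| ≤ L * ‖v‖ * fderiv ℝ η x ν) (hL : 0 ≤ L) :
    0 ≤ fderiv ℝ η x ν := by
  by_contra hneg
  have h1 := h ν
  have h2 : L * ‖ν‖ * fderiv ℝ η x ν ≤ 0 :=
    mul_nonpos_of_nonneg_of_nonpos (by positivity) (not_le.1 hneg).le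
  have h3 := abs_pos.2 (not_le.1 hneg).ne
  linarith

/-- The weights appearing in the localization of `Ω` near a boundary point. -/
structure IsLocalCutoff (Ω : Set R3) (ν : R3) (L M : ℝ) (χ η : R3 → ℝ) : Prop where
  smooth_left : ContDiff ℝ ((⊤ : ℕ∞) : WithTop ℕ∞) χ
  smooth_right : ContDiff ℝ ((⊤ : ℕ∞) : WithTop ℕ∞) η
  isTestFunction : IsTestFunction Ω fun y => χ y * η y
  nonneg_left : ∀ y, 0 ≤ χ y
  le_one_left : ∀ y, χ y ≤ 1
  nonneg_right : ∀ y, 0 ≤ η y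
  le_one_right : ∀ y, η y ≤ 1
  compactSupport_left : HasCompactSupport χ
  abs_fderiv_left_le : ∀ y v, |fderiv ℝ χ y v| ≤ M * ‖v‖
  abs_fderiv_right_le : ∀ y v, |fderiv ℝ η y v| ≤ L * ‖v‖ * fderiv ℝ η y ν
  norm_le_one : ‖ν‖ ≤ 1
  nonneg : 0 ≤ L
  nonneg' : 0 ≤ M

lemma IsLocalCutoff.continuous_weight (h : IsLocalCutoff Ω ν L M χ η) :
    Continuous fun x => χ x * fderiv ℝ η x ν :=
  h.smooth_left.continuous.mul
    ((h.smooth_right.continuous_fderiv (by simp)).clm_apply continuous_const)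

lemma IsLocalCutoff.integrable_weight (h : IsLocalCutoff Ω ν L M χ η) (hu : IsH1 Ω u) :
    Integrable (fun x => (χ x * fderiv ℝ η x ν) * ‖u x‖ ^ 2) (volume.restrict Ω) := by
  obtain ⟨C, hC⟩ := (h.compactSupport_left.mul_right
    (f' := fun x => fderiv ℝ η x ν)).exists_bound_of_continuous h.continuous_weight
  exact hu.integrable_norm_sq.bdd_mul h.continuous_weight.aestronglyMeasurable (.of_forall hC)

lemma two_mul_norm_mul_norm_sum_le (a : ℝ) (f : Fin 3 → R3) (v : Fin 3 → ℝ) (hv : ∀ k, |v k| ≤ 1) :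
    2 * (‖∑ k, v k • f k‖ * a) ≤ a ^ 2 + 3 * ∑ k, ‖f k‖ ^ 2 := by
  have h1 : ‖∑ k, v k • f k‖ ≤ ∑ k, ‖f k‖ := by
    refine (norm_sum_le _ _).trans (Finset.sum_le_sum fun k _ => ?_)
    rw [norm_smul]
    exact mul_le_of_le_one_left (norm_nonneg _) (hv k)
  have h2 := pow_le_pow_left₀ (norm_nonneg _) h1 2
  have h3 : (∑ k, ‖f k‖) ^ 2 ≤ 3 * ∑ k, ‖f k‖ ^ 2 := by
    simpa using sq_sum_le_card_mul_sum_sq (s := Finset.univ) (f := fun k => ‖f k‖)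
  nlinarith [sq_nonneg (‖∑ k, v k • f k‖ - a)]

/-- The mass of `|u|²` in a thin layer along the boundary is controlled by the `H¹` norm. -/
lemma IsLocalCutoff.integral_weight_le (hΩ : IsOpen Ω) (hfin : volume Ω ≠ ∞)
    (h : IsLocalCutoff Ω ν L M χ η) (hu : IsH1 Ω u) :
    ∫ x in Ω, (χ x * fderiv ℝ η x ν) * ‖u x‖ ^ 2 ≤ (M + 4) * h1Energy Ω u := by
  set D : R3 → R3 := fun x => ∑ k, ν k • weakGrad Ω u k x with hD
  have hDm : MemLp D 2 (volume.restrict Ω) :=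
    memLp_finsetSum _ fun k _ => (hu.weakGrad_spec.memLp k).const_smul (ν k)
  -- The field with rows νₖ u has divergence ∂_νu. Pairing it with u gives the integral of
  -- ∂_ν(χη)|u|².
  have key := (hu.hasWeakDiv_const_smul hfin ν).integral_inner hΩ hfin
    (fun k => hu.memLp.const_smul (ν k)) hDm hu.memLp hu.weakGrad_spec h.isTestFunction
  obtain ⟨C, hC⟩ := h.isTestFunction.exists_bound
  have i1 : Integrable (fun x => (χ x * η x) * inner ℝ (D x) (u x)) (volume.restrict Ω) :=
    (hDm.integrable_inner_two hu.memLp).bdd_mul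
      h.isTestFunction.continuous.aestronglyMeasurable (.of_forall hC)
  have i2 : Integrable (fun x => (η x * fderiv ℝ χ x ν) * ‖u x‖ ^ 2) (volume.restrict Ω) := by
    refine hu.integrable_norm_sq.bdd_mul (c := 1 * (M * ‖ν‖)) (Continuous.aestronglyMeasurable
      (h.smooth_right.continuous.mul
        ((h.smooth_left.continuous_fderiv (by simp)).clm_apply continuous_const)))
      (.of_forall fun x => ?_)
    rw [norm_mul]
    refine mul_le_mul ?_ (h.abs_fderiv_left_le x ν) (norm_nonneg _) zero_le_one
    rw [Real.norm_of_nonneg (h.nonneg_right x)]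
    exact h.le_one_right x
  have i3 := h.integrable_weight hu
  have e1 : ∫ x in Ω, ∑ k, (partialDeriv k (fun y => χ y * η y) x * inner ℝ (ν k • u x) (u x)
      + (χ x * η x) * inner ℝ (ν k • u x) (weakGrad Ω u k x))
      = (∫ x in Ω, (χ x * fderiv ℝ η x ν) * ‖u x‖ ^ 2)
        + (∫ x in Ω, (η x * fderiv ℝ χ x ν) * ‖u x‖ ^ 2)
        + ∫ x in Ω, (χ x * η x) * inner ℝ (D x) (u x) := by
    rw [← integral_add i3 i2, ← integral_add (by exact i3.add i2) i1]
    refine integral_congr_ae (.of_forall fun x => ?_)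
    have h1 := fderiv_mul_apply (h.smooth_left.differentiable (by simp))
      (h.smooth_right.differentiable (by simp)) x ν
    rw [fderiv_apply_eq_sum] at h1
    have h2 : ∑ k, (partialDeriv k (fun y => χ y * η y) x * inner ℝ (ν k • u x) (u x)
        + (χ x * η x) * inner ℝ (ν k • u x) (weakGrad Ω u k x))
        = (∑ k, ν k * partialDeriv k (fun y => χ y * η y) x) * ‖u x‖ ^ 2
          + (χ x * η x) * inner ℝ (D x) (u x) := by
      rw [real_inner_comm, hD, inner_sum, Finset.sum_mul, Finset.mul_sum,
        ← Finset.sum_add_distrib]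
      refine Finset.sum_congr rfl fun k _ => ?_
      rw [real_inner_smul_left, real_inner_smul_left, real_inner_smul_right,
        real_inner_self_eq_norm_sq]
      ring
    simp only []
    rw [h2, h1]
    ring
  rw [e1] at key
  -- The pairing of ∂_νu with u stands on both sides of the formula, whence the factor 2. No
  -- derivative of η is left on the right, so the bound is uniform in η.
  have e2 : ∫ x in Ω, (χ x * fderiv ℝ η x ν) * ‖u x‖ ^ 2
      = - ∫ x in Ω, ((η x * fderiv ℝ χ x ν) * ‖u x‖ ^ 2
          + 2 * ((χ x * η x) * inner ℝ (D x) (u x))) := by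
    rw [integral_add i2 (i1.const_mul 2), integral_const_mul]
    linarith
  rw [e2]
  refine (neg_le_abs _).trans ?_
  rw [h1Energy, ← integral_const_mul, ← Real.norm_eq_abs]
  refine norm_integral_le_of_norm_le (hu.integrable_h1Density.const_mul _) (.of_forall fun x => ?_)
  have b1 : |η x * fderiv ℝ χ x ν| ≤ M := by
    rw [abs_mul, abs_of_nonneg (h.nonneg_right x)]
    have := h.abs_fderiv_left_le x ν
    have h2 : M * ‖ν‖ ≤ M := mul_le_of_le_one_right h.nonneg' h.norm_le_one
    have := mul_le_of_le_one_left (abs_nonneg (fderiv ℝ χ x ν)) (h.le_one_right x)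
    linarith
  have b2 : |χ x * η x| ≤ 1 := by
    rw [abs_mul, abs_of_nonneg (h.nonneg_right x), abs_of_nonneg (h.nonneg_left x)]
    exact mul_le_one₀ (h.le_one_left x) (h.nonneg_right x) (h.le_one_right x)
  have b3 := two_mul_norm_mul_norm_sum_le ‖u x‖ (fun k => weakGrad Ω u k x) (fun k => ν k)
    fun k => (PiLp.norm_apply_le ν k).trans h.norm_le_one
  have b4 : |inner ℝ (D x) (u x)| ≤ ‖D x‖ * ‖u x‖ := abs_real_inner_le_norm _ _
  have b5 := norm_sq_weakGrad_le_h1Density Ω u x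
  have b6 := norm_sq_le_h1Density Ω u x
  have b7 := h.nonneg'
  calc ‖(η x * fderiv ℝ χ x ν) * ‖u x‖ ^ 2 + 2 * ((χ x * η x) * inner ℝ (D x) (u x))‖
      ≤ |η x * fderiv ℝ χ x ν| * ‖u x‖ ^ 2 + 2 * (|χ x * η x| * |inner ℝ (D x) (u x)|) := by
        refine (norm_add_le _ _).trans (le_of_eq ?_)
        simp [abs_mul]
    _ ≤ M * ‖u x‖ ^ 2 + 2 * (1 * (‖D x‖ * ‖u x‖)) := by gcongr
    _ ≤ (M + 4) * h1Density Ω u x := by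
        have := mul_le_mul_of_nonneg_left b6 b7
        linarith

/-- Young's inequality; the difference of the sides is (ta − b)²/t. -/
lemma two_mul_le_weighted (ht : 0 < t) (a b : ℝ) : 2 * (a * b) ≤ t * a ^ 2 + b ^ 2 / t := by
  have h : t * a ^ 2 + b ^ 2 / t - 2 * (a * b) = (t * a - b) ^ 2 / t := by
    field_simp
    ring
  have := div_nonneg (sq_nonneg (t * a - b)) ht.le
  linarith

/-- The localized estimate of the divergence of `je ⊗ w`. -/
lemma IsLocalCutoff.abs_integral_inner_le (hΩ : IsOpen Ω) (hfin : volume Ω ≠ ∞)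
    (h : IsLocalCutoff Ω ν L M χ η) (hje : AEStronglyMeasurable je (volume.restrict Ω))
    (hJ : ∀ᵐ x ∂(volume.restrict Ω), ‖je x‖ ≤ J) (hJ0 : 0 ≤ J) (hw : IsH1 Ω w) (hφ : IsH1 Ω φ)
    (hF : MemLp F 2 (volume.restrict Ω)) (hdiv : HasWeakDiv Ω (fun k x => je x k • w x) F)
    (ht : 0 < t) :
    |∫ x in Ω, (χ x * η x) * inner ℝ (F x) (φ x)|
      ≤ (M + 3 + L * (M + 4)) * J * (t * h1Energy Ω w + h1Energy Ω φ / t) := by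
  rw [hdiv.integral_inner hΩ hfin (fun k => hw.memLp.coord_smul hje hJ k) hF hφ.memLp
    hφ.weakGrad_spec h.isTestFunction, abs_neg]
  let s : R3 → ℝ := fun x => χ x * fderiv ℝ η x ν
  let e : R3 → ℝ := fun x => t * h1Density Ω w x + t⁻¹ * h1Density Ω φ x
  have ie : Integrable e (volume.restrict Ω) :=
    (hw.integrable_h1Density.const_mul t).add (hφ.integrable_h1Density.const_mul t⁻¹)
  have is : Integrable (fun x => t * (s x * ‖w x‖ ^ 2) + t⁻¹ * (s x * ‖φ x‖ ^ 2))
      (volume.restrict Ω) :=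
    ((h.integrable_weight hw).const_mul t).add ((h.integrable_weight hφ).const_mul t⁻¹)
  have hbound : |∫ x in Ω, ∑ k, (partialDeriv k (fun y => χ y * η y) x
        * inner ℝ (je x k • w x) (φ x)
      + (χ x * η x) * inner ℝ (je x k • w x) (weakGrad Ω φ k x))|
      ≤ ∫ x in Ω, (J * (M + 3) * e x
        + J * L * (t * (s x * ‖w x‖ ^ 2) + t⁻¹ * (s x * ‖φ x‖ ^ 2))) := by
    rw [← Real.norm_eq_abs]
    refine norm_integral_le_of_norm_le ((ie.const_mul _).add (is.const_mul _)) ?_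
    filter_upwards [hJ] with x hx
    have b2 : |χ x * η x| ≤ 1 := by
      rw [abs_mul, abs_of_nonneg (h.nonneg_right x), abs_of_nonneg (h.nonneg_left x)]
      exact mul_le_one₀ (h.le_one_left x) (h.nonneg_right x) (h.le_one_right x)
    have hs0 : 0 ≤ s x := mul_nonneg (h.nonneg_left x)
      (fderiv_nonneg_of_abs_le (h.abs_fderiv_right_le x) h.nonneg)
    have hL := h.nonneg
    have hM := h.nonneg'
    have e1 : ∑ k, (partialDeriv k (fun y => χ y * η y) x * inner ℝ (je x k • w x) (φ x)
        + (χ x * η x) * inner ℝ (je x k • w x) (weakGrad Ω φ k x))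
        = (χ x * fderiv ℝ η x (je x) + η x * fderiv ℝ χ x (je x)) * inner ℝ (w x) (φ x)
          + ∑ k, (χ x * η x) * (je x k * inner ℝ (w x) (weakGrad Ω φ k x)) := by
      rw [← fderiv_mul_apply (h.smooth_left.differentiable (by simp))
        (h.smooth_right.differentiable (by simp)), fderiv_apply_eq_sum, Finset.sum_mul,
        ← Finset.sum_add_distrib]
      refine Finset.sum_congr rfl fun k _ => ?_
      rw [real_inner_smul_left, real_inner_smul_left]
      ring
    -- The derivative of η along jₑ is at most L|jₑ| ∂_νη. This turns the layer term into the weight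
    -- controlled by `IsLocalCutoff.integral_weight_le`.
    have b1 : |χ x * fderiv ℝ η x (je x) + η x * fderiv ℝ χ x (je x)| ≤ J * (L * s x + M) := by
      have c1 : χ x * |fderiv ℝ η x (je x)| ≤ J * (L * s x) := by
        calc χ x * |fderiv ℝ η x (je x)| ≤ χ x * (L * ‖je x‖ * fderiv ℝ η x ν) :=
              mul_le_mul_of_nonneg_left (h.abs_fderiv_right_le x _) (h.nonneg_left x)
          _ = ‖je x‖ * (L * s x) := by simp only [s]; ring
          _ ≤ J * (L * s x) := by gcongr
      have c2 : η x * |fderiv ℝ χ x (je x)| ≤ J * M := by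
        calc η x * |fderiv ℝ χ x (je x)| ≤ 1 * (M * ‖je x‖) :=
              mul_le_mul (h.le_one_right x) (h.abs_fderiv_left_le x _) (abs_nonneg _) zero_le_one
          _ ≤ J * M := by rw [one_mul, mul_comm]; gcongr
      refine (abs_add_le _ _).trans ?_
      rw [abs_mul, abs_mul, abs_of_nonneg (h.nonneg_right x), abs_of_nonneg (h.nonneg_left x)]
      linarith
    have b3 : |inner ℝ (w x) (φ x)| ≤ (t * ‖w x‖ ^ 2 + t⁻¹ * ‖φ x‖ ^ 2) / 2 := by
      have c1 := abs_real_inner_le_norm (w x) (φ x)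
      have c2 := two_mul_le_weighted ht ‖w x‖ ‖φ x‖
      rw [div_eq_inv_mul] at c2
      linarith
    have b4 : ∀ k, |(χ x * η x) * (je x k * inner ℝ (w x) (weakGrad Ω φ k x))|
        ≤ J * ((t * ‖w x‖ ^ 2 + t⁻¹ * ‖weakGrad Ω φ k x‖ ^ 2) / 2) := by
      intro k
      have c1 := abs_real_inner_le_norm (w x) (weakGrad Ω φ k x)
      have c2 := two_mul_le_weighted ht ‖w x‖ ‖weakGrad Ω φ k x‖
      rw [div_eq_inv_mul] at c2
      have c3 : |je x k| ≤ J := (PiLp.norm_apply_le _ k).trans hx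
      rw [abs_mul (χ x * η x), abs_mul (je x k)]
      calc |χ x * η x| * (|je x k| * |inner ℝ (w x) (weakGrad Ω φ k x)|)
          ≤ 1 * (J * ((t * ‖w x‖ ^ 2 + t⁻¹ * ‖weakGrad Ω φ k x‖ ^ 2) / 2)) := by
            gcongr
            linarith
        _ = _ := one_mul _
    have b5 := norm_sq_weakGrad_le_h1Density Ω φ x
    have b6 := norm_sq_le_h1Density Ω φ x
    have b7 := norm_sq_le_h1Density Ω w x
    have b8 : t * ‖w x‖ ^ 2 + t⁻¹ * ‖φ x‖ ^ 2 ≤ e x := by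
      simp only [e]
      gcongr
    have b9 : 3 * (t * ‖w x‖ ^ 2) + t⁻¹ * ∑ k, ‖weakGrad Ω φ k x‖ ^ 2 ≤ 3 * e x := by
      have c1 : t * ‖w x‖ ^ 2 ≤ t * h1Density Ω w x := by gcongr
      have c2 : t⁻¹ * ∑ k, ‖weakGrad Ω φ k x‖ ^ 2 ≤ t⁻¹ * h1Density Ω φ x := by gcongr
      have c3 : 0 ≤ t⁻¹ * h1Density Ω φ x :=
        mul_nonneg (inv_nonneg.2 ht.le) (h1Density_nonneg _ _ _)
      simp only [e]
      linarith
    have he0 : 0 ≤ e x := add_nonneg (mul_nonneg ht.le (h1Density_nonneg _ _ _))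
      (mul_nonneg (inv_nonneg.2 ht.le) (h1Density_nonneg _ _ _))
    rw [e1]
    calc _ ≤ |χ x * fderiv ℝ η x (je x) + η x * fderiv ℝ χ x (je x)| * |inner ℝ (w x) (φ x)|
          + ∑ k, |(χ x * η x) * (je x k * inner ℝ (w x) (weakGrad Ω φ k x))| := by
          refine (norm_add_le _ _).trans (add_le_add (norm_mul _ _).le (norm_sum_le _ _))
      _ ≤ (J * (L * s x + M)) * ((t * ‖w x‖ ^ 2 + t⁻¹ * ‖φ x‖ ^ 2) / 2)
          + ∑ k, J * ((t * ‖w x‖ ^ 2 + t⁻¹ * ‖weakGrad Ω φ k x‖ ^ 2) / 2) := by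
          gcongr with k
          exact b4 k
      _ = J * L * (t * (s x * ‖w x‖ ^ 2) + t⁻¹ * (s x * ‖φ x‖ ^ 2)) / 2
          + J * M * (t * ‖w x‖ ^ 2 + t⁻¹ * ‖φ x‖ ^ 2) / 2
          + J * (3 * (t * ‖w x‖ ^ 2) + t⁻¹ * ∑ k, ‖weakGrad Ω φ k x‖ ^ 2) / 2 := by
          simp only [Fin.sum_univ_three]
          ring
      _ ≤ J * L * (t * (s x * ‖w x‖ ^ 2) + t⁻¹ * (s x * ‖φ x‖ ^ 2))
          + J * M * e x + J * (3 * e x) := by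
          have c1 : 0 ≤ J * L * (t * (s x * ‖w x‖ ^ 2) + t⁻¹ * (s x * ‖φ x‖ ^ 2)) := by positivity
          have c2 : J * M * (t * ‖w x‖ ^ 2 + t⁻¹ * ‖φ x‖ ^ 2) ≤ J * M * e x := by gcongr
          have c3 := mul_le_mul_of_nonneg_left b9 hJ0
          have c4 : 0 ≤ J * M * e x := by positivity
          have c5 : 0 ≤ J * e x := by positivity
          linarith
      _ = _ := by ring
  refine hbound.trans ?_
  rw [integral_add (ie.const_mul _) (is.const_mul _), integral_const_mul, integral_const_mul,
    integral_add ((h.integrable_weight hw).const_mul t) ((h.integrable_weight hφ).const_mul t⁻¹),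
    integral_const_mul, integral_const_mul,
    integral_add (hw.integrable_h1Density.const_mul t) (hφ.integrable_h1Density.const_mul t⁻¹),
    integral_const_mul, integral_const_mul]
  have d1 := h.integral_weight_le hΩ hfin hw
  have d2 := h.integral_weight_le hΩ hfin hφ
  have hL := h.nonneg
  change J * (M + 3) * (t * h1Energy Ω w + t⁻¹ * h1Energy Ω φ) + _ ≤ _
  calc _ ≤ J * (M + 3) * (t * h1Energy Ω w + t⁻¹ * h1Energy Ω φ)
        + J * L * (t * ((M + 4) * h1Energy Ω w) + t⁻¹ * ((M + 4) * h1Energy Ω φ)) := by gcongr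
    _ = _ := by rw [div_eq_inv_mul]; ring

end BoundaryEstimate

/-! ### The global divergence estimate. -/

section GlobalEstimate

open Filter Topology
open scoped Manifold

variable {Ω : Set R3}

/-- The estimates for the divergence of `je ⊗ w`, localized by the weight `χ`. -/
def HasDivBound (Ω : Set R3) (χ : R3 → ℝ) (C : ℝ) : Prop :=
  ∀ (je w φ F : R3 → R3) (J t : ℝ), AEStronglyMeasurable je (volume.restrict Ω) →
    (∀ᵐ x ∂(volume.restrict Ω), ‖je x‖ ≤ J) → 0 ≤ J → IsH1 Ω w → IsH1 Ω φ →
    MemLp F 2 (volume.restrict Ω) → HasWeakDiv Ω (fun k x => je x k • w x) F → 0 < t →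
    |∫ x in Ω, χ x * inner ℝ (F x) (φ x)| ≤ C * J * (t * h1Energy Ω w + h1Energy Ω φ / t)

/-- The constant of the localized estimate depends on L and on a bound M of the gradient of χ, not
on n. So the cutoffs can be removed by dominated convergence. -/
lemma IsCutoffSeq.exists_hasDivBound (hΩ : IsOpen Ω) (hfin : volume Ω ≠ ∞) {x₀ : R3} {r L : ℝ}
    {ν : R3} {η : ℕ → R3 → ℝ} (hη : IsCutoffSeq Ω (Metric.ball x₀ r) ν L η) (hν : ‖ν‖ ≤ 1)
    (hL : 0 ≤ L) {χ : R3 → ℝ} (hχ : ContDiff ℝ ((⊤ : ℕ∞) : WithTop ℕ∞) χ)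
    (hsupp : tsupport χ ⊆ Metric.ball x₀ r) (h0 : ∀ y, 0 ≤ χ y) (h1 : ∀ y, χ y ≤ 1) :
    ∃ C, 0 ≤ C ∧ HasDivBound Ω χ C := by
  have hcs : HasCompactSupport χ :=
    Metric.isCompact_of_isClosed_isBounded (isClosed_tsupport χ)
      (Metric.isBounded_ball.subset hsupp)
  obtain ⟨M, hM⟩ := (hcs.fderiv ℝ).exists_bound_of_continuous
    (hχ.continuous_fderiv (by simp))
  have hM0 : 0 ≤ M := (norm_nonneg _).trans (hM 0)
  have hloc : ∀ n, IsLocalCutoff Ω ν L M χ (η n) := fun n =>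
    { smooth_left := hχ
      smooth_right := hη.smooth n
      isTestFunction :=
        ⟨hχ.mul (hη.smooth n), hcs.mul_right, fun y hy => hη.tsupport_inter_subset n
          ⟨tsupport_mul_subset_right hy, hsupp (tsupport_mul_subset_left hy)⟩⟩
      nonneg_left := h0
      le_one_left := h1
      nonneg_right := hη.nonneg n
      le_one_right := hη.le_one n
      compactSupport_left := hcs
      abs_fderiv_left_le := fun y v => ((fderiv ℝ χ y).le_opNorm v).trans (by gcongr; exact hM y)
      abs_fderiv_right_le := hη.abs_fderiv_le n
      norm_le_one := hν
      nonneg := hL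
      nonneg' := hM0 }
  refine ⟨M + 3 + L * (M + 4), by positivity, fun je w φ F J t hje hJ hJ0 hw hφ hF hdiv ht => ?_⟩
  have hint := hF.integrable_inner_two hφ.memLp
  have hlim : Tendsto (fun n => ∫ x in Ω, (χ x * η n x) * inner ℝ (F x) (φ x)) atTop
      (𝓝 (∫ x in Ω, χ x * inner ℝ (F x) (φ x))) := by
    refine tendsto_integral_of_dominated_convergence (fun x => ‖(inner ℝ (F x) (φ x) : ℝ)‖)
      (fun n => (hloc n).isTestFunction.continuous.aestronglyMeasurable.mul
        hint.aestronglyMeasurable) hint.norm (fun n => .of_forall fun x => ?_) ?_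
    · rw [norm_mul, norm_mul, Real.norm_of_nonneg (h0 x), Real.norm_of_nonneg (hη.nonneg n x)]
      exact mul_le_of_le_one_left (norm_nonneg _)
        (mul_le_one₀ (h1 x) (hη.nonneg n x) (hη.le_one n x))
    · filter_upwards [ae_restrict_mem hΩ.measurableSet] with x hx
      by_cases hB : x ∈ Metric.ball x₀ r
      · refine tendsto_const_nhds.congr' ?_
        filter_upwards [hη.eventually_eq_one x ⟨hx, hB⟩] with n hn
        rw [hn, mul_one]
      · have : χ x = 0 := image_eq_zero_of_notMem_tsupport fun h => hB (hsupp h)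
        simp [this]
  exact le_of_tendsto hlim.abs (.of_forall fun n =>
    (hloc n).abs_integral_inner_le hΩ hfin hje hJ hJ0 hw hφ hF hdiv ht)

/-- The closure of Ω is compact, so finitely many balls carry a smooth partition of unity; the local
constants add up. -/
theorem IsBoundedLipschitzDomain.exists_hasDivBound (hΩ : IsBoundedLipschitzDomain Ω) :
    ∃ C, 0 ≤ C ∧ HasDivBound Ω (fun _ => 1) C := by
  have hfin : volume Ω ≠ ∞ := hΩ.isBounded.measure_lt_top.ne
  choose! r ν L η hr hν hL hη using fun (x : R3) (hx : x ∈ closure Ω) =>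
    hΩ.exists_isCutoffSeq hx
  have hcpt : IsCompact (closure Ω) := hΩ.isBounded.isCompact_closure
  obtain ⟨T, hT, hcov⟩ := hcpt.elim_nhds_subcover (fun x => Metric.ball x (r x))
    fun x hx => Metric.ball_mem_nhds x (hr x hx)
  obtain ⟨f, hf⟩ := SmoothPartitionOfUnity.exists_isSubordinate 𝓘(ℝ, R3)
    (isClosed_closure (s := Ω)) (fun i : T => Metric.ball (i : R3) (r i))
    (fun _ => Metric.isOpen_ball) (fun x hx => by
      obtain ⟨i, hi, hxi⟩ := Set.mem_iUnion₂.1 (hcov hx)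
      exact Set.mem_iUnion.2 ⟨⟨i, hi⟩, hxi⟩)
  choose C hC0 hC using fun i : T => (hη i (hT i i.2)).exists_hasDivBound hΩ.isOpen hfin
    (hν i (hT i i.2)) (hL i (hT i i.2)) (f i).contMDiff.contDiff (hf i) (f.nonneg i) (f.le_one i)
  refine ⟨∑ i, C i, Finset.sum_nonneg fun i _ => hC0 i,
    fun je w φ F J t hje hJ hJ0 hw hφ hF hdiv ht => ?_⟩
  have hint := hF.integrable_inner_two hφ.memLp
  have hsum : ∫ x in Ω, 1 * (inner ℝ (F x) (φ x) : ℝ)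
      = ∑ i, ∫ x in Ω, f i x * inner ℝ (F x) (φ x) := by
    rw [← integral_finsetSum]
    · refine integral_congr_ae ?_
      filter_upwards [ae_restrict_mem hΩ.isOpen.measurableSet] with x hx
      rw [← Finset.sum_mul, ← finsum_eq_sum_of_fintype, f.sum_eq_one (subset_closure hx)]
    · refine fun i _ => hint.bdd_mul (c := 1) (f i).contMDiff.continuous.aestronglyMeasurable
        (.of_forall fun x => ?_)
      rw [Real.norm_of_nonneg (f.nonneg i x)]
      exact f.le_one i x
  rw [hsum]
  refine (Finset.abs_sum_le_sum_abs _ _).trans ?_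
  rw [Finset.sum_mul, Finset.sum_mul]
  exact Finset.sum_le_sum fun i _ => hC i je w φ F J t hje hJ hJ0 hw hφ hF hdiv ht

end GlobalEstimate

/-! ### Multiplication operators on `L²`. -/

section PointwiseOperator

variable {α : Type*} [MeasurableSpace α] {μ : Measure α} {E : Type*} [NormedAddCommGroup E]
  [InnerProductSpace ℝ E]

/-- The operator on `L²` which acts by a bounded field of linear maps. -/
lemma exists_pointwise_operator (N : α → E →ₗ[ℝ] E)
    (hN : ∀ p : α → E, AEStronglyMeasurable p μ → AEStronglyMeasurable (fun x => N x (p x)) μ)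
    {C : ℝ} (hC : ∀ᵐ x ∂μ, ∀ w, ‖N x w‖ ≤ C * ‖w‖) :
    ∃ T : Lp E 2 μ →L[ℝ] Lp E 2 μ, ∀ p, T p =ᵐ[μ] fun x => N x (p x) := by
  have hmem : ∀ p : Lp E 2 μ, MemLp (fun x => N x (p x)) 2 μ := fun p =>
    (Lp.memLp p).of_le_mul (hN _ (Lp.aestronglyMeasurable p)) (hC.mono fun x hx => hx _)
  let T₀ : Lp E 2 μ →ₗ[ℝ] Lp E 2 μ :=
    { toFun := fun p => (hmem p).toLp _
      map_add' := fun p q => by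
        ext1
        filter_upwards [(hmem (p + q)).coeFn_toLp, Lp.coeFn_add p q,
          Lp.coeFn_add ((hmem p).toLp _) ((hmem q).toLp _), (hmem p).coeFn_toLp,
          (hmem q).coeFn_toLp] with x h1 h2 h3 h4 h5
        rw [h1, h3, Pi.add_apply, h4, h5, h2, Pi.add_apply, map_add]
      map_smul' := fun c p => by
        ext1
        filter_upwards [(hmem (c • p)).coeFn_toLp, Lp.coeFn_smul c p,
          Lp.coeFn_smul c ((hmem p).toLp _), (hmem p).coeFn_toLp] with x h1 h2 h3 h4
        rw [h1, RingHom.id_apply, h3, Pi.smul_apply, h4, h2, Pi.smul_apply, map_smul] }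
  refine ⟨T₀.mkContinuous C fun p => ?_, fun p => (hmem p).coeFn_toLp⟩
  refine Lp.norm_le_mul_norm_of_ae_le_mul ?_
  filter_upwards [(hmem p).coeFn_toLp, hC] with x h1 h2
  exact (congrArg norm h1).trans_le (h2 _)

end PointwiseOperator

/-! ### Lax–Milgram on a closed subspace. -/

section LaxMilgram

variable {H : Type*} [NormedAddCommGroup H] [InnerProductSpace ℝ H] [CompleteSpace H]

/-- The Lax–Milgram theorem on a closed subspace of a Hilbert space. -/
lemma Submodule.exists_forall_inner_eq (V : Submodule ℝ H) (hV : IsClosed (V : Set H))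
    (T : H →L[ℝ] H) {c : ℝ} (hc : 0 < c) (hT : ∀ v ∈ V, c * ‖v‖ ^ 2 ≤ inner ℝ (T v) v) (f : H) :
    ∃ v ∈ V, ∀ w ∈ V, inner ℝ (T v) w = inner ℝ f w := by
  have : CompleteSpace V := hV.completeSpace_coe
  let B : V →L[ℝ] V →L[ℝ] ℝ := LinearMap.mkContinuous₂
    (LinearMap.mk₂ ℝ (fun v w : V => (inner ℝ (T v) (w : H) : ℝ))
      (fun a b w => by simp [inner_add_left]) (fun r a w => by simp [real_inner_smul_left])
      (fun a b w => by simp [inner_add_right]) (fun r a w => by simp [real_inner_smul_right]))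
    ‖T‖ (fun v w => by
      refine (norm_inner_le_norm _ _).trans ?_
      exact mul_le_mul_of_nonneg_right (T.le_opNorm v) (norm_nonneg _))
  have hB : ∀ v w : V, B v w = inner ℝ (T v) (w : H) := fun v w => rfl
  have hcoer : IsCoercive B := ⟨c, hc, fun v => by
    rw [hB]
    have := hT v v.2
    rw [mul_assoc, ← sq]
    exact this⟩
  let ℓ : V →L[ℝ] ℝ := (innerSL ℝ f).comp V.subtypeL
  let v := hcoer.continuousLinearEquivOfBilin.symm ((InnerProductSpace.toDual ℝ V).symm ℓ)
  refine ⟨v, v.2, fun w hw => ?_⟩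
  have h := hcoer.continuousLinearEquivOfBilin_apply v ⟨w, hw⟩
  rw [hB, ContinuousLinearEquiv.apply_symm_apply, InnerProductSpace.toDual_symm_apply] at h
  exact h.symm

end LaxMilgram

/-! ### `H¹` as a closed subspace of `L²`. -/

section JetSpace

/-- The space of the values of a vector field on `ℝ³` and of its gradient. -/
abbrev Jet : Type := PiLp 2 fun _ : Option (Fin 3) => R3

/-- The field of the values of `u` and of `G`. -/
noncomputable def jet (u : R3 → R3) (G : Fin 3 → R3 → R3) (x : R3) : Jet :=
  WithLp.toLp 2 fun o => o.elim (u x) fun i => G i x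

variable {Ω : Set R3} {u : R3 → R3} {G : Fin 3 → R3 → R3}

@[simp] lemma jet_none (x : R3) : jet u G x none = u x := rfl

@[simp] lemma jet_some (x : R3) (i : Fin 3) : jet u G x (some i) = G i x := rfl

lemma memLp_jet {μ : Measure R3} {p : ℝ≥0∞} (hu : MemLp u p μ) (hG : ∀ i, MemLp (G i) p μ) :
    MemLp (jet u G) p μ := by
  refine memLp_piLp_iff.2 fun o => ?_
  cases o with
  | none => exact hu
  | some i => exact hG i

lemma jet_inner (a b : Jet) :
    (inner ℝ a b : ℝ) = inner ℝ (a none) (b none) + ∑ i, inner ℝ (a (some i)) (b (some i)) := by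
  rw [PiLp.inner_apply, Fintype.sum_option]

lemma jet_norm_sq (a : Jet) : ‖a‖ ^ 2 = ‖a none‖ ^ 2 + ∑ i, ‖a (some i)‖ ^ 2 := by
  rw [PiLp.norm_sq_eq_of_L2, Fintype.sum_option]

/-- The jet which tests the weak derivative `∂ᵢ` in the direction `e`. -/
noncomputable def testJet (i : Fin 3) (e : R3) (ψ : R3 → ℝ) : R3 → Jet :=
  jet (fun x => partialDeriv i ψ x • e) fun j x => if j = i then ψ x • e else 0

lemma IsTestFunction.memLp_testJet (hfin : volume Ω ≠ ∞) {ψ : R3 → ℝ} (hψ : IsTestFunction Ω ψ)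
    (i : Fin 3) (e : R3) : MemLp (testJet i e ψ) 2 (volume.restrict Ω) := by
  have : IsFiniteMeasure (volume.restrict Ω) := ⟨by simpa using hfin.lt_top⟩
  refine memLp_jet ((hψ.partialDeriv i).memLp_smul (memLp_const e)) fun j => ?_
  by_cases h : j = i
  · simpa [h] using hψ.memLp_smul (memLp_const e)
  · simp [h]

lemma inner_testJet (i : Fin 3) (e : R3) (ψ : R3 → ℝ) (x : R3) (a : Jet) :
    (inner ℝ (testJet i e ψ x) a : ℝ)
      = inner ℝ e (partialDeriv i ψ x • a none + ψ x • a (some i)) := by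
  rw [jet_inner]
  simp only [testJet, jet_none, jet_some, inner_add_right, real_inner_smul_right,
    real_inner_smul_left]
  rw [Finset.sum_eq_single i (fun j _ hj => by simp [hj]) (by simp)]
  simp [real_inner_smul_left]

/-- The graph of the weak gradient, as a subspace of `L²`. -/
noncomputable def gradGraph (Ω : Set R3) : Submodule ℝ (Lp Jet 2 (volume.restrict Ω)) where
  -- The weak derivative relation is orthogonality to all test jets, and this makes the subspace
  -- closed. Quantifying over h dispenses with any hypothesis on Ω in the definition.
  carrier := {p | ∀ ψ, IsTestFunction Ω ψ → ∀ (i : Fin 3) (e : R3)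
    (h : MemLp (testJet i e ψ) 2 (volume.restrict Ω)), inner ℝ (h.toLp _) p = (0 : ℝ)}
  add_mem' hp hq ψ hψ i e h := by rw [inner_add_right, hp ψ hψ i e h, hq ψ hψ i e h, add_zero]
  zero_mem' ψ hψ i e h := inner_zero_right _
  smul_mem' c p hp ψ hψ i e h := by rw [inner_smul_right, hp ψ hψ i e h, mul_zero]

lemma isClosed_gradGraph (Ω : Set R3) :
    IsClosed (gradGraph Ω : Set (Lp Jet 2 (volume.restrict Ω))) := by
  have : (gradGraph Ω : Set (Lp Jet 2 (volume.restrict Ω)))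
      = ⋂ (ψ) (_ : IsTestFunction Ω ψ) (i : Fin 3) (e : R3)
          (h : MemLp (testJet i e ψ) 2 (volume.restrict Ω)),
          {p | (inner ℝ (h.toLp _) p : ℝ) = 0} := by
    ext p
    simp only [Set.mem_iInter]
    rfl
  rw [this]
  exact isClosed_iInter fun ψ => isClosed_iInter fun hψ => isClosed_iInter fun i =>
    isClosed_iInter fun e => isClosed_iInter fun h =>
      isClosed_eq (continuous_const.inner continuous_id) continuous_const

lemma integral_inner_testJet (hfin : volume Ω ≠ ∞) {ψ : R3 → ℝ} (hψ : IsTestFunction Ω ψ)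
    (i : Fin 3) (e : R3) (h : MemLp (testJet i e ψ) 2 (volume.restrict Ω))
    {a : R3 → Jet} (ha : MemLp a 2 (volume.restrict Ω)) {p : Lp Jet 2 (volume.restrict Ω)}
    (hp : p =ᵐ[volume.restrict Ω] a) :
    (inner ℝ (h.toLp _) p : ℝ) = inner ℝ e ((∫ x in Ω, partialDeriv i ψ x • a x none)
      + ∫ x in Ω, ψ x • a x (some i)) := by
  have i1 := (hψ.partialDeriv i).integrable_smul hfin (ha.eval_piLp none)
  have i2 := hψ.integrable_smul hfin (ha.eval_piLp (some i))
  rw [← integral_add i1 i2, ← integral_inner (by exact i1.add i2) e, L2.inner_def]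
  refine integral_congr_ae ?_
  filter_upwards [h.coeFn_toLp, hp] with x h1 h2
  rw [h1, h2, inner_testJet]

lemma IsL2WeakGrad.toLp_mem_gradGraph (hfin : volume Ω ≠ ∞) (hG : IsL2WeakGrad Ω u G)
    (hu : MemLp u 2 (volume.restrict Ω)) :
    (memLp_jet hu hG.memLp).toLp _ ∈ gradGraph Ω := by
  intro ψ hψ i e h
  rw [integral_inner_testJet hfin hψ i e h (memLp_jet hu hG.memLp) (MemLp.coeFn_toLp _)]
  simp [hG.integral_eq ψ hψ i]

lemma isL2WeakGrad_of_mem_gradGraph (hfin : volume Ω ≠ ∞) {p : Lp Jet 2 (volume.restrict Ω)}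
    (hp : p ∈ gradGraph Ω) : IsL2WeakGrad Ω (fun x => p x none) (fun i x => p x (some i)) where
  memLp i := (Lp.memLp p).eval_piLp (some i)
  integral_eq ψ hψ i := by
    refine eq_neg_of_add_eq_zero_left (ext_inner_left ℝ fun e => ?_)
    rw [← integral_inner_testJet hfin hψ i e (hψ.memLp_testJet hfin i e) (Lp.memLp p) .rfl,
      hp ψ hψ i e, inner_zero_right]

end JetSpace

/-! ### Pointwise bounds and coercivity of the coefficients. -/

section Coefficients

/-- The diffusive part of the spin current. -/
noncomputable def spinFlux (d b : ℝ) (m g : R3) : R3 := d • (g - (b * inner ℝ g m) • m)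

/-- The zeroth order part of the spin-diffusion equation. -/
noncomputable def spinReact (γ₁ γ₂ : ℝ) (m u : R3) : R3 := γ₁ • u + γ₂ • cross u m

variable {d b γ γ₁ γ₂ D : ℝ} {m g u : R3}

lemma spinFlux_add (g' : R3) : spinFlux d b m (g + g') = spinFlux d b m g + spinFlux d b m g' := by
  simp only [spinFlux, inner_add_left, ← smul_add]
  congr 1
  module

lemma spinFlux_smul (c : ℝ) : spinFlux d b m (c • g) = c • spinFlux d b m g := by
  simp only [spinFlux, real_inner_smul_left]
  module

lemma spinReact_add (u' : R3) :
    spinReact γ₁ γ₂ m (u + u') = spinReact γ₁ γ₂ m u + spinReact γ₁ γ₂ m u' := by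
  simp only [spinReact, cross_add_left]
  module

lemma spinReact_smul (c : ℝ) : spinReact γ₁ γ₂ m (c • u) = c • spinReact γ₁ γ₂ m u := by
  simp only [spinReact, cross_smul_left]
  module

lemma norm_spinFlux_le (hd : |d| ≤ D) (hb : |b| ≤ 1) (hm : ‖m‖ = 1) :
    ‖spinFlux d b m g‖ ≤ 2 * D * ‖g‖ := by
  have h1 : ‖g - (b * inner ℝ g m) • m‖ ≤ 2 * ‖g‖ := by
    have h2 : |(inner ℝ g m : ℝ)| ≤ ‖g‖ := by simpa [hm] using abs_real_inner_le_norm g m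
    refine (norm_sub_le _ _).trans ?_
    rw [norm_smul, hm, mul_one, norm_mul, Real.norm_eq_abs, Real.norm_eq_abs]
    have := mul_le_mul hb h2 (abs_nonneg _) zero_le_one
    linarith
  rw [spinFlux, norm_smul, Real.norm_eq_abs]
  calc |d| * ‖g - (b * inner ℝ g m) • m‖ ≤ D * (2 * ‖g‖) :=
        mul_le_mul hd h1 (norm_nonneg _) ((abs_nonneg _).trans hd)
    _ = _ := by ring

lemma norm_spinReact_le (h1 : 0 ≤ γ₁) (h2 : 0 ≤ γ₂) (hm : ‖m‖ = 1) :
    ‖spinReact γ₁ γ₂ m u‖ ≤ (γ₁ + γ₂) * ‖u‖ := by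
  have h3 := norm_cross_le u m
  rw [hm, mul_one] at h3
  refine (norm_add_le _ _).trans ?_
  rw [norm_smul, norm_smul, Real.norm_of_nonneg h1, Real.norm_of_nonneg h2, add_mul]
  gcongr

/-- As |m| = 1, the removed part b(g·m)² is at most b|g|². -/
lemma le_inner_spinFlux_self (hγ : 0 ≤ γ) (hd : γ ≤ d) (hb0 : 0 ≤ b) (hb : b ≤ 1) (hm : ‖m‖ = 1) :
    γ * (1 - b) * ‖g‖ ^ 2 ≤ inner ℝ (spinFlux d b m g) g := by
  have h2 : (inner ℝ g m : ℝ) ^ 2 ≤ ‖g‖ ^ 2 := by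
    refine sq_le_sq' ?_ ?_ <;> have := abs_le.1 (abs_real_inner_le_norm g m) <;>
      rw [hm, mul_one] at this
    exacts [this.1, this.2]
  have h3 : (inner ℝ (spinFlux d b m g) g : ℝ) = d * (‖g‖ ^ 2 - b * inner ℝ g m ^ 2) := by
    rw [spinFlux, real_inner_smul_left, inner_sub_left, real_inner_smul_left,
      real_inner_self_eq_norm_sq, real_inner_comm]
    ring
  rw [h3]
  have h4 : (1 - b) * ‖g‖ ^ 2 ≤ ‖g‖ ^ 2 - b * inner ℝ g m ^ 2 := by
    have := mul_le_mul_of_nonneg_left h2 hb0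
    linarith
  have h5 : 0 ≤ (1 - b) * ‖g‖ ^ 2 := mul_nonneg (by linarith) (sq_nonneg _)
  calc γ * (1 - b) * ‖g‖ ^ 2 = γ * ((1 - b) * ‖g‖ ^ 2) := by ring
    _ ≤ d * (‖g‖ ^ 2 - b * inner ℝ g m ^ 2) := mul_le_mul hd h4 h5 (hγ.trans hd)

lemma inner_spinReact_self : inner ℝ (spinReact γ₁ γ₂ m u) u = γ₁ * ‖u‖ ^ 2 := by
  rw [spinReact, inner_add_left, real_inner_smul_left, real_inner_smul_left, inner_cross_self,
    real_inner_self_eq_norm_sq, mul_zero, add_zero]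

lemma MeasureTheory.AEStronglyMeasurable.spinFlux {μ : Measure R3} {D₀ : R3 → ℝ} {m g : R3 → R3}
    (hD : AEStronglyMeasurable D₀ μ) (hm : AEStronglyMeasurable m μ)
    (hg : AEStronglyMeasurable g μ) (b : ℝ) :
    AEStronglyMeasurable (fun x => spinFlux (D₀ x) b (m x) (g x)) μ :=
  hD.smul (hg.sub (((hg.inner hm).const_mul b).smul hm))

lemma MeasureTheory.AEStronglyMeasurable.spinReact {μ : Measure R3} {m u : R3 → R3}
    (hm : AEStronglyMeasurable m μ) (hu : AEStronglyMeasurable u μ) (γ₁ γ₂ : ℝ) :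
    AEStronglyMeasurable (fun x => spinReact γ₁ γ₂ (m x) (u x)) μ :=
  (hu.const_smul γ₁).add
    ((continuous_cross.comp_aestronglyMeasurable (hu.prodMk hm)).const_smul γ₂)

/-- The pointwise linear map of the spin-diffusion equation. -/
noncomputable def spinMap (d b γ₁ γ₂ : ℝ) (m : R3) : Jet →ₗ[ℝ] Jet where
  toFun w := WithLp.toLp 2 fun o =>
    o.elim (spinReact γ₁ γ₂ m (w none)) fun i => spinFlux d b m (w (some i))
  map_add' v w := by
    ext1 o
    cases o with
    | none => exact spinReact_add _
    | some i => exact spinFlux_add _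
  map_smul' c w := by
    ext1 o
    cases o with
    | none => exact spinReact_smul _
    | some i => exact spinFlux_smul _

@[simp] lemma spinMap_none (w : Jet) :
    spinMap d b γ₁ γ₂ m w none = spinReact γ₁ γ₂ m (w none) := rfl

@[simp] lemma spinMap_some (w : Jet) (i : Fin 3) :
    spinMap d b γ₁ γ₂ m w (some i) = spinFlux d b m (w (some i)) := rfl

lemma norm_spinMap_le (hd : |d| ≤ D) (hb : |b| ≤ 1) (h1 : 0 ≤ γ₁) (h2 : 0 ≤ γ₂) (hm : ‖m‖ = 1)
    (w : Jet) : ‖spinMap d b γ₁ γ₂ m w‖ ≤ (2 * D + (γ₁ + γ₂)) * ‖w‖ := by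
  have hD : 0 ≤ D := (abs_nonneg d).trans hd
  refine le_of_sq_le_sq ?_ (by positivity)
  rw [mul_pow, jet_norm_sq, jet_norm_sq w, mul_add, Finset.mul_sum]
  simp only [spinMap_none, spinMap_some, ← mul_pow]
  gcongr with i
  · refine (norm_spinReact_le h1 h2 hm).trans ?_
    exact mul_le_mul_of_nonneg_right (by linarith) (norm_nonneg _)
  · refine (norm_spinFlux_le hd hb hm).trans ?_
    exact mul_le_mul_of_nonneg_right (by linarith) (norm_nonneg _)

lemma le_inner_spinMap_self (hγ : 0 ≤ γ) (hd : γ ≤ d) (hb0 : 0 ≤ b) (hb : b ≤ 1) (hm : ‖m‖ = 1)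
    (w : Jet) : min γ₁ (γ * (1 - b)) * ‖w‖ ^ 2 ≤ inner ℝ (spinMap d b γ₁ γ₂ m w) w := by
  rw [jet_inner, jet_norm_sq, mul_add, Finset.mul_sum]
  simp only [spinMap_none, spinMap_some, inner_spinReact_self]
  gcongr with i
  · exact min_le_left _ _
  · refine le_trans ?_ (le_inner_spinFlux_self hγ hd hb0 hb hm)
    gcongr
    exact min_le_right _ _

end Coefficients

/-! ### Existence of weak solutions. -/

section Existence

variable {Ω : Set R3} {D₀ : R3 → ℝ} {b γ γ₁ γ₂ D : ℝ} {m : R3 → R3}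

/-- Existence for the weak spin-diffusion equation with a right-hand side in `L²`. -/
lemma exists_weak_solution (hfin : volume Ω ≠ ∞)
    (hD₀ : AEStronglyMeasurable D₀ (volume.restrict Ω))
    (hD : ∀ᵐ x ∂(volume.restrict Ω), |D₀ x| ≤ D) (hγ : 0 < γ)
    (hD₀γ : ∀ᵐ x ∂(volume.restrict Ω), γ ≤ D₀ x) (hb0 : 0 ≤ b) (hb : b < 1) (h1 : 0 < γ₁)
    (h2 : 0 ≤ γ₂) (hm : AEStronglyMeasurable m (volume.restrict Ω))
    (hm1 : ∀ᵐ x ∂(volume.restrict Ω), ‖m x‖ = 1) {f : R3 → R3}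
    (hf : MemLp f 2 (volume.restrict Ω)) :
    ∃ s G, MemLp s 2 (volume.restrict Ω) ∧ IsL2WeakGrad Ω s G ∧ ∀ φ H,
      MemLp φ 2 (volume.restrict Ω) → IsL2WeakGrad Ω φ H →
      ∫ x in Ω, (inner ℝ (spinReact γ₁ γ₂ (m x) (s x)) (φ x)
        + ∑ i, inner ℝ (spinFlux (D₀ x) b (m x) (G i x)) (H i x))
        = ∫ x in Ω, inner ℝ (f x) (φ x) := by
  have hb1 : |b| ≤ 1 := abs_le.2 ⟨by linarith, hb.le⟩
  obtain ⟨T, hT⟩ := exists_pointwise_operator (μ := volume.restrict Ω)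
    (fun x => spinMap (D₀ x) b γ₁ γ₂ (m x))
    (fun p hp => by
      have hp' : ∀ o, AEStronglyMeasurable (fun x => p x o) (volume.restrict Ω) := fun o =>
        (PiLp.continuous_apply 2 _ o).comp_aestronglyMeasurable hp
      refine (PiLp.continuous_toLp 2 _).comp_aestronglyMeasurable
        (aemeasurable_pi_iff.2 fun o => AEStronglyMeasurable.aemeasurable ?_).aestronglyMeasurable
      cases o with
      | none => exact hm.spinReact (hp' none) γ₁ γ₂
      | some i => exact hD₀.spinFlux hm (hp' (some i)) b)
    (C := 2 * D + (γ₁ + γ₂)) (by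
      filter_upwards [hD, hm1] with x hx1 hx2 w
      exact norm_spinMap_le hx1 hb1 h1.le h2 hx2 w)
  have hc : 0 < min γ₁ (γ * (1 - b)) := lt_min h1 (mul_pos hγ (by linarith))
  have hF : MemLp (jet f fun _ _ => 0) 2 (volume.restrict Ω) :=
    memLp_jet hf fun _ => MemLp.zero'
  -- Coercivity is pointwise and holds for every jet in L²; membership in the graph plays no role in
  -- it.
  obtain ⟨v, hv, hsol⟩ := (gradGraph Ω).exists_forall_inner_eq (isClosed_gradGraph Ω) T hc
    (fun v _ => by
      rw [L2.inner_def, ← real_inner_self_eq_norm_sq, L2.inner_def, ← integral_const_mul]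
      refine integral_mono_ae ((L2.integrable_inner v v).const_mul _) (L2.integrable_inner _ v) ?_
      filter_upwards [hT v, hD₀γ, hm1] with x hx1 hx2 hx3
      rw [hx1, real_inner_self_eq_norm_sq]
      exact le_inner_spinMap_self hγ.le hx2 hb0 hb.le hx3 _) (hF.toLp _)
  refine ⟨_, _, (Lp.memLp v).eval_piLp none, isL2WeakGrad_of_mem_gradGraph hfin hv,
    fun φ H hφ hH => ?_⟩
  have key := hsol _ (hH.toLp_mem_gradGraph hfin hφ)
  rw [L2.inner_def, L2.inner_def] at key
  have hw := (memLp_jet hφ hH.memLp).coeFn_toLp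
  calc _ = _ := ?_
    _ = _ := key
    _ = _ := ?_
  · refine integral_congr_ae ?_
    filter_upwards [hT v, hw] with x hx1 hx2
    rw [hx1, hx2, jet_inner]
    rfl
  · refine integral_congr_ae ?_
    filter_upwards [hF.coeFn_toLp, hw] with x hx1 hx2
    rw [hx1, hx2, jet_inner]
    simp

end Existence

/-! ### Functions smooth up to the boundary, and the `C¹` norm. -/

section ClassicalGradient

variable {Ω : Set R3} {k : ℕ} {v u : R3 → R3}

lemma IsCkClosure.contDiffOn_one (hv : IsCkClosure k Ω v) (hk : 1 ≤ k) : ContDiffOn ℝ 1 v Ω :=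
  hv.contDiffOn.of_le (by exact_mod_cast hk)

lemma IsCkClosure.memLp (hv : IsCkClosure k Ω v) (hΩ : IsOpen Ω) (hb : Bornology.IsBounded Ω) :
    MemLp v 2 (volume.restrict Ω) := by
  have : IsFiniteMeasure (volume.restrict Ω) := ⟨by simpa using hb.measure_lt_top⟩
  obtain ⟨G, hG, hGv⟩ := hv.extends_continuously 0 (Nat.zero_le k)
  obtain ⟨C, hC⟩ := hb.isCompact_closure.exists_bound_of_continuousOn hG
  refine MemLp.of_bound (hv.contDiffOn.continuousOn.aestronglyMeasurable hΩ.measurableSet) C ?_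
  filter_upwards [ae_restrict_mem hΩ.measurableSet] with x hx
  have := hC x (subset_closure hx)
  rwa [hGv x hx, norm_iteratedFDeriv_zero] at this

lemma IsCkClosure.memLp_fderiv (hv : IsCkClosure k Ω v) (hk : 1 ≤ k) (hΩ : IsOpen Ω)
    (hb : Bornology.IsBounded Ω) (e : R3) :
    MemLp (fun x => fderiv ℝ v x e) 2 (volume.restrict Ω) := by
  have : IsFiniteMeasure (volume.restrict Ω) := ⟨by simpa using hb.measure_lt_top⟩
  obtain ⟨G, hG, hGv⟩ := hv.extends_continuously 1 hk
  obtain ⟨C, hC⟩ := hb.isCompact_closure.exists_bound_of_continuousOn hG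
  have hcont : ContinuousOn (fun x => fderiv ℝ v x e) Ω :=
    ((hv.contDiffOn_one hk).continuousOn_fderiv_of_isOpen hΩ le_rfl).clm_apply continuousOn_const
  refine MemLp.of_bound (hcont.aestronglyMeasurable hΩ.measurableSet) (C * ‖e‖) ?_
  filter_upwards [ae_restrict_mem hΩ.measurableSet] with x hx
  have := hC x (subset_closure hx)
  rw [hGv x hx, norm_iteratedFDeriv_one] at this
  exact ((fderiv ℝ v x).le_opNorm e).trans (by gcongr)

/-- The product ψv, extended by zero, can be integrated by parts on the whole space, where
differentiability of v is needed only on the support of ψ. -/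
lemma IsCkClosure.isL2WeakGrad (hv : IsCkClosure k Ω v) (hk : 1 ≤ k) (hΩ : IsOpen Ω)
    (hb : Bornology.IsBounded Ω) :
    IsL2WeakGrad Ω v fun i x => fderiv ℝ v x (EuclideanSpace.single i 1) where
  memLp i := hv.memLp_fderiv hk hΩ hb _
  integral_eq ψ hψ i := by
    have : IsFiniteMeasure (volume.restrict Ω) := ⟨by simpa using hb.measure_lt_top⟩
    have hint : ∀ {θ : R3 → ℝ} {w : R3 → R3}, IsTestFunction Ω θ →
        MemLp w 2 (volume.restrict Ω) → Integrable fun y => θ y • w y :=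
      fun hθ hw => memLp_one_iff_integrable.1
        (hθ.memLp_smul_volume hΩ.measurableSet (hw.mono_exponent (by norm_num)))
    have key := integral_smul_fderiv_eq_neg_fderiv_smul_of_integrable (μ := volume) (f := ψ)
      (g := v) (v := EuclideanSpace.single i 1)
      (hint (hψ.partialDeriv i) (hv.memLp hΩ hb)) (hint hψ (hv.memLp_fderiv hk hΩ hb _))
      (hint hψ (hv.memLp hΩ hb)) (fun x _ => hψ.differentiable x)
      (fun x hx => ((hv.contDiffOn_one hk).contDiffAt
        (hΩ.mem_nhds (hψ.support_subset hx))).differentiableAt (by simp))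
    rw [hψ.integral_smul_eq_setIntegral] at key
    rw [key, neg_neg]
    exact ((hψ.partialDeriv i).integral_smul_eq_setIntegral v).symm

lemma IsCkClosure.isH1 (hv : IsCkClosure k Ω v) (hk : 1 ≤ k) (hΩ : IsOpen Ω)
    (hb : Bornology.IsBounded Ω) : IsH1 Ω v :=
  ⟨hv.memLp hΩ hb, _, hv.isL2WeakGrad hk hΩ hb⟩

/-- Each admissible representative bounds the essential supremum, hence so does the infimum. Passing
through the essential supremum avoids a null set for each representative. -/
lemma ae_enorm_le_c1Norm (hΩ : IsOpen Ω) (u : R3 → R3) :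
    ∀ᵐ x ∂(volume.restrict Ω), ‖u x‖ₑ ≤ c1Norm Ω u := by
  have h : eLpNormEssSup u (volume.restrict Ω) ≤ c1Norm Ω u := by
    refine le_iInf₂ fun v hv => eLpNormEssSup_le_of_ae_enorm_bound ?_
    filter_upwards [hv.2, ae_restrict_mem hΩ.measurableSet] with x hx hxΩ
    rw [← hx]
    exact (le_iSup₂ (f := fun x (_ : x ∈ Ω) => ‖v x‖ₑ) x hxΩ).trans le_self_add
  filter_upwards [enorm_ae_le_eLpNormEssSup u (volume.restrict Ω)] with x hx
  exact hx.trans h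

lemma IsH1.ae_enorm_weakGrad_le_c1Norm (hΩ : IsOpen Ω) (hb : Bornology.IsBounded Ω)
    (hu : IsH1 Ω u) (i : Fin 3) :
    ∀ᵐ x ∂(volume.restrict Ω), ‖weakGrad Ω u i x‖ₑ ≤ c1Norm Ω u := by
  have h : eLpNormEssSup (weakGrad Ω u i) (volume.restrict Ω) ≤ c1Norm Ω u := by
    refine le_iInf₂ fun v hv => eLpNormEssSup_le_of_ae_enorm_bound ?_
    filter_upwards [hu.weakGrad_spec.ae_eq hΩ hb.measure_lt_top.ne
      (hv.1.isL2WeakGrad le_rfl hΩ hb) hv.2.symm i, ae_restrict_mem hΩ.measurableSet] with x hx hxΩ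
    rw [hx]
    refine le_trans ?_ ((le_iSup₂ (f := fun x (_ : x ∈ Ω) => ‖fderiv ℝ v x‖ₑ) x hxΩ).trans
      le_add_self)
    have h1 : ‖(EuclideanSpace.single i 1 : R3)‖ₑ = 1 := by
      rw [← ofReal_norm]
      simp
    simpa [h1] using (fderiv ℝ v x).le_opENorm (EuclideanSpace.single i 1)
  filter_upwards [enorm_ae_le_eLpNormEssSup (weakGrad Ω u i) (volume.restrict Ω)] with x hx
  exact hx.trans h

end ClassicalGradient

/-! ### Solutions of the spin-diffusion equation: existence, uniqueness, stability. -/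

section SpinAccumulation

variable {Ω : Set R3} {D₀ : R3 → ℝ} {b β β' γ γ₁ γ₂ D : ℝ}
  {m m' m₁ m₂ s s' s₁ s₂ je F F₁ F₂ φ : R3 → R3}

/-- The density of the bilinear form of the spin-diffusion equation. -/
noncomputable def spinDensity (Ω : Set R3) (D₀ : R3 → ℝ) (b γ₁ γ₂ : ℝ) (m s φ : R3 → R3) (x : R3) :
    ℝ :=
  inner ℝ (spinReact γ₁ γ₂ (m x) (s x)) (φ x)
    + ∑ i, inner ℝ (spinFlux (D₀ x) b (m x) (weakGrad Ω s i x)) (weakGrad Ω φ i x)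

lemma IsH1.memLp_spinFlux (hs : IsH1 Ω s) (hD₀ : AEStronglyMeasurable D₀ (volume.restrict Ω))
    (hD : ∀ᵐ x ∂(volume.restrict Ω), |D₀ x| ≤ D) (hb : |b| ≤ 1) (hm : IsH1Sphere Ω m)
    (i : Fin 3) :
    MemLp (fun x => spinFlux (D₀ x) b (m x) (weakGrad Ω s i x)) 2 (volume.restrict Ω) := by
  refine (hs.weakGrad_spec.memLp i).of_le_mul (c := 2 * D) (hD₀.spinFlux
    hm.isH1.memLp.aestronglyMeasurable (hs.weakGrad_spec.memLp i).aestronglyMeasurable b) ?_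
  filter_upwards [hD, hm.norm_eq_one] with x h1 h2
  exact norm_spinFlux_le h1 hb h2

lemma IsH1.memLp_spinReact (hs : IsH1 Ω s) (h1 : 0 ≤ γ₁) (h2 : 0 ≤ γ₂) (hm : IsH1Sphere Ω m) :
    MemLp (fun x => spinReact γ₁ γ₂ (m x) (s x)) 2 (volume.restrict Ω) := by
  refine hs.memLp.of_le_mul (c := γ₁ + γ₂) (hm.isH1.memLp.aestronglyMeasurable.spinReact
    hs.memLp.aestronglyMeasurable γ₁ γ₂) ?_
  filter_upwards [hm.norm_eq_one] with x hx
  exact norm_spinReact_le h1 h2 hx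

lemma IsH1.integrable_spinDensity (hs : IsH1 Ω s) (hφ : IsH1 Ω φ)
    (hD₀ : AEStronglyMeasurable D₀ (volume.restrict Ω))
    (hD : ∀ᵐ x ∂(volume.restrict Ω), |D₀ x| ≤ D) (hb : |b| ≤ 1) (h1 : 0 ≤ γ₁) (h2 : 0 ≤ γ₂)
    (hm : IsH1Sphere Ω m) :
    Integrable (spinDensity Ω D₀ b γ₁ γ₂ m s φ) (volume.restrict Ω) :=
  ((hs.memLp_spinReact h1 h2 hm).integrable_inner_two hφ.memLp).add <|
    integrable_finsetSum _ fun i _ =>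
      (hs.memLp_spinFlux hD₀ hD hb hm i).integrable_inner_two (hφ.weakGrad_spec.memLp i)

lemma IsH1.integral_spinDensity (hs : IsH1 Ω s) (hφ : IsH1 Ω φ)
    (hD₀ : AEStronglyMeasurable D₀ (volume.restrict Ω))
    (hD : ∀ᵐ x ∂(volume.restrict Ω), |D₀ x| ≤ D) (hb : |b| ≤ 1) (h1 : 0 ≤ γ₁) (h2 : 0 ≤ γ₂)
    (hm : IsH1Sphere Ω m) :
    ∫ x in Ω, spinDensity Ω D₀ b γ₁ γ₂ m s φ x
      = (∫ x in Ω, ∑ i, inner ℝ (spinFlux (D₀ x) b (m x) (weakGrad Ω s i x)) (weakGrad Ω φ i x))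
        + ∫ x in Ω, inner ℝ (spinReact γ₁ γ₂ (m x) (s x)) (φ x) := by
  rw [add_comm]
  exact integral_add ((hs.memLp_spinReact h1 h2 hm).integrable_inner_two hφ.memLp)
    (integrable_finsetSum _ fun i _ =>
      (hs.memLp_spinFlux hD₀ hD hb hm i).integrable_inner_two (hφ.weakGrad_spec.memLp i))

lemma exists_ae_norm_le_of_continuousOn_closure (hΩ : IsOpen Ω) (hbd : Bornology.IsBounded Ω)
    (hje : ContinuousOn je (closure Ω)) : ∃ J, ∀ᵐ x ∂(volume.restrict Ω), ‖je x‖ ≤ J := by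
  obtain ⟨J, hJ⟩ := hbd.isCompact_closure.exists_bound_of_continuousOn hje
  refine ⟨J, ?_⟩
  filter_upwards [ae_restrict_mem hΩ.measurableSet] with x hx
  exact hJ x (subset_closure hx)

theorem exists_isSpinAccumulation (hΩ : IsOpen Ω) (hbd : Bornology.IsBounded Ω)
    (hD₀ : AEStronglyMeasurable D₀ (volume.restrict Ω))
    (hD : ∀ᵐ x ∂(volume.restrict Ω), |D₀ x| ≤ D) (hγ : 0 < γ)
    (hD₀γ : ∀ᵐ x ∂(volume.restrict Ω), γ ≤ D₀ x) (hb0 : 0 ≤ β * β') (hb : β * β' < 1)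
    (h1 : 0 < γ₁) (h2 : 0 ≤ γ₂) (hje : IsH1 Ω je) (hjec : ContinuousOn je (closure Ω))
    (hm : IsH1Sphere Ω m) : ∃ s, IsSpinAccumulation Ω D₀ β β' γ₁ γ₂ je m s := by
  have hfin : volume Ω ≠ ∞ := hbd.measure_lt_top.ne
  obtain ⟨J, hJ⟩ := exists_ae_norm_le_of_continuousOn_closure hΩ hbd hjec
  obtain ⟨F, hF, hdiv⟩ := hje.exists_hasWeakDiv_smul hΩ hfin hJ hm.isH1
    (hm.norm_eq_one.mono fun _ h => h.le)
  obtain ⟨s, G, hs, hG, hsol⟩ := exists_weak_solution hfin hD₀ hD hγ hD₀γ hb0 hb h1 h2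
    hm.isH1.memLp.aestronglyMeasurable hm.norm_eq_one (hF.const_smul (-(β / 2)))
  have hsH : IsH1 Ω s := ⟨hs, G, hG⟩
  refine ⟨s, hsH, F, hF, hdiv, fun φ hφ => ?_⟩
  have hb1 : |β * β'| ≤ 1 := abs_le.2 ⟨by linarith, hb.le⟩
  have key := hsol φ _ hφ.memLp hφ.weakGrad_spec
  refine (hsH.integral_spinDensity hφ hD₀ hD hb1 h1.le h2 hm).symm.trans ?_
  have e1 : ∫ x in Ω, spinDensity Ω D₀ (β * β') γ₁ γ₂ m s φ x
      = ∫ x in Ω, (inner ℝ (spinReact γ₁ γ₂ (m x) (s x)) (φ x)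
        + ∑ i, inner ℝ (spinFlux (D₀ x) (β * β') (m x) (G i x)) (weakGrad Ω φ i x)) := by
    refine integral_congr_ae ?_
    filter_upwards [ae_all_iff.2 fun i => hG.weakGrad_ae_eq hΩ hfin i] with x hx
    simp only [spinDensity, hx]
  rw [e1, key, ← integral_const_mul]
  simp [real_inner_smul_left]

/-- The definition only supplies some divergence; its uniqueness almost everywhere allows any
prescribed F, so that solutions can be compared with common data. -/
lemma IsSpinAccumulation.integral_eq (hΩ : IsOpen Ω) (hfin : volume Ω ≠ ∞)
    (hD₀ : AEStronglyMeasurable D₀ (volume.restrict Ω))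
    (hD : ∀ᵐ x ∂(volume.restrict Ω), |D₀ x| ≤ D) (hb : |β * β'| ≤ 1) (h1 : 0 ≤ γ₁) (h2 : 0 ≤ γ₂)
    (hm : IsH1Sphere Ω m) (hs : IsSpinAccumulation Ω D₀ β β' γ₁ γ₂ je m s)
    (hF : MemLp F 2 (volume.restrict Ω)) (hdiv : HasWeakDiv Ω (fun k x => je x k • m x) F)
    (hφ : IsH1 Ω φ) :
    ∫ x in Ω, spinDensity Ω D₀ (β * β') γ₁ γ₂ m s φ x
      = -(β / 2) * ∫ x in Ω, inner ℝ (F x) (φ x) := by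
  obtain ⟨F', hF', hdiv', heq⟩ := hs.weak_eq
  rw [hs.isH1.integral_spinDensity hφ hD₀ hD hb h1 h2 hm]
  refine (heq φ hφ).trans ?_
  congr 1
  refine integral_congr_ae ?_
  filter_upwards [hdiv'.ae_eq hΩ hfin hdiv hF' hF] with x hx
  rw [hx]

lemma IsSpinAccumulation.congr (h : m =ᵐ[volume.restrict Ω] m')
    (hs : IsSpinAccumulation Ω D₀ β β' γ₁ γ₂ je m s) :
    IsSpinAccumulation Ω D₀ β β' γ₁ γ₂ je m' s := by
  obtain ⟨F, hF, hdiv, heq⟩ := hs.weak_eq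
  refine ⟨hs.isH1, F, hF, hdiv.congr fun k => ?_, fun φ hφ => ?_⟩
  · filter_upwards [h] with x hx
    rw [hx]
  · rw [← heq φ hφ]
    congr 1 <;> refine integral_congr_ae ?_ <;> filter_upwards [h] with x hx <;> simp only [hx]

lemma spinDensity_sub (hΩ : IsOpen Ω) (hfin : volume Ω ≠ ∞) (hs : IsH1 Ω s) (hs' : IsH1 Ω s') :
    spinDensity Ω D₀ b γ₁ γ₂ m (s - s') φ =ᵐ[volume.restrict Ω] fun x =>
      spinDensity Ω D₀ b γ₁ γ₂ m s φ x - spinDensity Ω D₀ b γ₁ γ₂ m s' φ x := by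
  filter_upwards [ae_all_iff.2 fun i => hs.weakGrad_sub hΩ hfin hs' i] with x hx
  have hr : spinReact γ₁ γ₂ (m x) (s x - s' x)
      = spinReact γ₁ γ₂ (m x) (s x) - spinReact γ₁ γ₂ (m x) (s' x) := by
    simp only [spinReact, cross_sub_left]
    module
  have hf : ∀ g g' : R3, spinFlux (D₀ x) b (m x) (g - g')
      = spinFlux (D₀ x) b (m x) g - spinFlux (D₀ x) b (m x) g' := fun g g' => by
    simp only [spinFlux, inner_sub_left]
    module
  simp only [spinDensity, hx, Pi.sub_apply, hr, hf, inner_sub_left, Finset.sum_sub_distrib]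
  ring

lemma h1Energy_le_integral_spinDensity (hγ : 0 ≤ γ) (hD₀γ : ∀ᵐ x ∂(volume.restrict Ω), γ ≤ D₀ x)
    (hD₀ : AEStronglyMeasurable D₀ (volume.restrict Ω))
    (hD : ∀ᵐ x ∂(volume.restrict Ω), |D₀ x| ≤ D) (hb0 : 0 ≤ b) (hb : b ≤ 1) (h1 : 0 ≤ γ₁)
    (h2 : 0 ≤ γ₂) (hm : IsH1Sphere Ω m) (hs : IsH1 Ω s) :
    min γ₁ (γ * (1 - b)) * h1Energy Ω s ≤ ∫ x in Ω, spinDensity Ω D₀ b γ₁ γ₂ m s s x := by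
  have hb1 : |b| ≤ 1 := abs_le.2 ⟨by linarith, hb⟩
  rw [h1Energy, ← integral_const_mul]
  refine integral_mono_ae (hs.integrable_h1Density.const_mul _)
    (hs.integrable_spinDensity hs hD₀ hD hb1 h1 h2 hm) ?_
  filter_upwards [hD₀γ, hm.norm_eq_one] with x hx1 hx2
  have := le_inner_spinMap_self (γ₁ := γ₁) (γ₂ := γ₂) hγ hx1 hb0 hb hx2 (jet s (weakGrad Ω s) x)
  rw [jet_norm_sq, jet_inner] at this
  exact this

/-- The difference of two solutions, tested with itself. -/
lemma IsSpinAccumulation.energy_sub_le (hΩ : IsOpen Ω) (hfin : volume Ω ≠ ∞)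
    (hγ : 0 ≤ γ) (hD₀γ : ∀ᵐ x ∂(volume.restrict Ω), γ ≤ D₀ x)
    (hD₀ : AEStronglyMeasurable D₀ (volume.restrict Ω))
    (hD : ∀ᵐ x ∂(volume.restrict Ω), |D₀ x| ≤ D) (hb0 : 0 ≤ β * β') (hb : β * β' ≤ 1)
    (h1 : 0 ≤ γ₁) (h2 : 0 ≤ γ₂) (hm₁ : IsH1Sphere Ω m₁) (hm₂ : IsH1Sphere Ω m₂)
    (hs₁ : IsSpinAccumulation Ω D₀ β β' γ₁ γ₂ je m₁ s₁)
    (hs₂ : IsSpinAccumulation Ω D₀ β β' γ₁ γ₂ je m₂ s₂)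
    (hF₁ : MemLp F₁ 2 (volume.restrict Ω)) (hdiv₁ : HasWeakDiv Ω (fun k x => je x k • m₁ x) F₁)
    (hF₂ : MemLp F₂ 2 (volume.restrict Ω)) (hdiv₂ : HasWeakDiv Ω (fun k x => je x k • m₂ x) F₂) :
    min γ₁ (γ * (1 - β * β')) * h1Energy Ω (s₁ - s₂)
      ≤ (∫ x in Ω, (spinDensity Ω D₀ (β * β') γ₁ γ₂ m₂ s₁ (s₁ - s₂) x
          - spinDensity Ω D₀ (β * β') γ₁ γ₂ m₁ s₁ (s₁ - s₂) x))
        + -(β / 2) * ∫ x in Ω, inner ℝ (F₁ x - F₂ x) ((s₁ - s₂) x) := by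
  have hb1 : |β * β'| ≤ 1 := abs_le.2 ⟨by linarith, hb⟩
  have hd : IsH1 Ω (s₁ - s₂) := hs₁.isH1.sub hfin hs₂.isH1
  refine (h1Energy_le_integral_spinDensity hγ hD₀γ hD₀ hD hb0 hb h1 h2 hm₂ hd).trans (le_of_eq ?_)
  -- With B the form and d = s₁ − s₂, this writes B(m₂; d, d) as B(m₂; s₁, d) − B(m₁; s₁, d) plus
  -- B(m₁; s₁, d) − B(m₂; s₂, d). The last difference is given by the two equations.
  rw [integral_congr_ae (spinDensity_sub hΩ hfin hs₁.isH1 hs₂.isH1)]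
  have i := fun {s m} (hs : IsH1 Ω s) (hm : IsH1Sphere Ω m) =>
    hs.integrable_spinDensity hd hD₀ hD hb1 h1 h2 hm
  rw [integral_sub (i hs₁.isH1 hm₂) (i hs₂.isH1 hm₂), integral_sub (i hs₁.isH1 hm₂)
    (i hs₁.isH1 hm₁), hs₁.integral_eq hΩ hfin hD₀ hD hb1 h1 h2 hm₁ hF₁ hdiv₁ hd,
    hs₂.integral_eq hΩ hfin hD₀ hD hb1 h1 h2 hm₂ hF₂ hdiv₂ hd]
  simp only [inner_sub_left]
  rw [integral_sub (hF₁.integrable_inner_two hd.memLp) (hF₂.integrable_inner_two hd.memLp)]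
  ring

lemma IsH1.ae_eq_of_h1Energy_sub_nonpos (hfin : volume Ω ≠ ∞) (hs₁ : IsH1 Ω s₁) (hs₂ : IsH1 Ω s₂)
    (h : h1Energy Ω (s₁ - s₂) ≤ 0) : s₁ =ᵐ[volume.restrict Ω] s₂ := by
  have h0 := (integral_eq_zero_iff_of_nonneg (fun _ => h1Density_nonneg _ _ _)
    (hs₁.sub hfin hs₂).integrable_h1Density).1 (le_antisymm h (h1Energy_nonneg _ _))
  filter_upwards [h0] with x hx
  have h3 := (norm_sq_le_h1Density Ω (s₁ - s₂) x).trans_eq hx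
  have h4 : ‖(s₁ - s₂) x‖ = 0 := pow_eq_zero_iff (two_ne_zero) |>.1
    (le_antisymm h3 (by positivity))
  exact sub_eq_zero.1 (norm_eq_zero.1 h4)

theorem IsSpinAccumulation.ae_eq (hΩ : IsOpen Ω) (hfin : volume Ω ≠ ∞)
    (hγ : 0 < γ) (hD₀γ : ∀ᵐ x ∂(volume.restrict Ω), γ ≤ D₀ x)
    (hD₀ : AEStronglyMeasurable D₀ (volume.restrict Ω))
    (hD : ∀ᵐ x ∂(volume.restrict Ω), |D₀ x| ≤ D) (hb0 : 0 ≤ β * β') (hb : β * β' < 1)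
    (h1 : 0 < γ₁) (h2 : 0 ≤ γ₂) (hm : IsH1Sphere Ω m)
    (hs₁ : IsSpinAccumulation Ω D₀ β β' γ₁ γ₂ je m s₁)
    (hs₂ : IsSpinAccumulation Ω D₀ β β' γ₁ γ₂ je m s₂) : s₁ =ᵐ[volume.restrict Ω] s₂ := by
  refine hs₁.isH1.ae_eq_of_h1Energy_sub_nonpos hfin hs₂.isH1 ?_
  obtain ⟨F, hF, hdiv, -⟩ := hs₁.weak_eq
  have hc : 0 < min γ₁ (γ * (1 - β * β')) := lt_min h1 (mul_pos hγ (by linarith))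
  have := hs₁.energy_sub_le hΩ hfin hγ.le hD₀γ hD₀ hD hb0 hb.le h1.le h2 hm hm hs₂ hF hdiv hF hdiv
  simp only [sub_self, inner_zero_left, integral_zero, mul_zero, add_zero] at this
  exact nonpos_of_mul_nonpos_right this hc

/-- The difference of the quadratic terms in m splits as (g·w)(m₁·h) + (g·m₂)(w·h), with w = m₁ −
m₂, g = ∂ᵢs and h = ∂ᵢφ. Each product is linear in w, and P absorbs g. -/
lemma abs_spinDensity_sub_le {P t : ℝ} {x : R3} (hD : |D₀ x| ≤ D) (hb : |b| ≤ 1) (h2 : 0 ≤ γ₂)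
    (hm₁ : ‖m₁ x‖ = 1) (hm₂ : ‖m₂ x‖ = 1) (hs : ‖s x‖ ≤ P)
    (hg : ∀ i, ‖weakGrad Ω s i x‖ ≤ P) (ht : 0 < t) :
    |spinDensity Ω D₀ b γ₁ γ₂ m₂ s φ x - spinDensity Ω D₀ b γ₁ γ₂ m₁ s φ x|
      ≤ (γ₂ + 4 * D) * P * (t * h1Density Ω (m₁ - m₂) x + h1Density Ω φ x / t) := by
  have hP : 0 ≤ P := (norm_nonneg _).trans hs
  have hD0 : 0 ≤ D := (abs_nonneg _).trans hD
  set w : R3 := m₁ x - m₂ x with hw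
  have key : ∀ v : R3, 2 * (‖w‖ * ‖v‖) ≤ t * ‖w‖ ^ 2 + ‖v‖ ^ 2 / t := fun v =>
    two_mul_le_weighted ht _ _
  have e1 : spinDensity Ω D₀ b γ₁ γ₂ m₂ s φ x - spinDensity Ω D₀ b γ₁ γ₂ m₁ s φ x
      = -(γ₂ * inner ℝ (cross (s x) w) (φ x))
        + ∑ i, (D₀ x * b) * (inner ℝ (weakGrad Ω s i x) w * inner ℝ (m₁ x) (weakGrad Ω φ i x)
          + inner ℝ (weakGrad Ω s i x) (m₂ x) * inner ℝ w (weakGrad Ω φ i x)) := by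
    simp only [spinDensity, spinReact, spinFlux, hw, cross_sub_right, inner_add_left,
      inner_sub_left, inner_sub_right, real_inner_smul_left, Fin.sum_univ_three]
    ring
  have b1 : |γ₂ * inner ℝ (cross (s x) w) (φ x)| ≤ γ₂ * P * (‖w‖ * ‖φ x‖) := by
    rw [abs_mul, abs_of_nonneg h2, mul_assoc]
    gcongr
    calc _ ≤ ‖cross (s x) w‖ * ‖φ x‖ := abs_real_inner_le_norm _ _
      _ ≤ (P * ‖w‖) * ‖φ x‖ := by
        gcongr
        exact (norm_cross_le _ _).trans (by gcongr)
      _ = _ := mul_assoc _ _ _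
  have b2 : ∀ i, |(D₀ x * b) * (inner ℝ (weakGrad Ω s i x) w * inner ℝ (m₁ x) (weakGrad Ω φ i x)
      + inner ℝ (weakGrad Ω s i x) (m₂ x) * inner ℝ w (weakGrad Ω φ i x))|
      ≤ D * P * (2 * (‖w‖ * ‖weakGrad Ω φ i x‖)) := by
    intro i
    have c1 : |(inner ℝ (weakGrad Ω s i x) w : ℝ)| ≤ P * ‖w‖ :=
      (abs_real_inner_le_norm _ _).trans (by gcongr; exact hg i)
    have c2 : |(inner ℝ (m₁ x) (weakGrad Ω φ i x) : ℝ)| ≤ ‖weakGrad Ω φ i x‖ := by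
      simpa [hm₁] using abs_real_inner_le_norm (m₁ x) (weakGrad Ω φ i x)
    have c3 : |(inner ℝ (weakGrad Ω s i x) (m₂ x) : ℝ)| ≤ P := by
      refine (abs_real_inner_le_norm _ _).trans ?_
      rw [hm₂, mul_one]
      exact hg i
    have c4 : |(inner ℝ w (weakGrad Ω φ i x) : ℝ)| ≤ ‖w‖ * ‖weakGrad Ω φ i x‖ :=
      abs_real_inner_le_norm _ _
    have c5 : |D₀ x * b| ≤ D := by
      rw [abs_mul]
      exact (mul_le_of_le_one_right (abs_nonneg _) hb).trans hD
    rw [abs_mul]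
    calc _ ≤ D * (|(inner ℝ (weakGrad Ω s i x) w : ℝ)| * |inner ℝ (m₁ x) (weakGrad Ω φ i x)|
          + |(inner ℝ (weakGrad Ω s i x) (m₂ x) : ℝ)| * |inner ℝ w (weakGrad Ω φ i x)|) := by
          refine mul_le_mul c5 ((abs_add_le _ _).trans_eq ?_) (abs_nonneg _) hD0
          rw [abs_mul, abs_mul]
      _ ≤ D * ((P * ‖w‖) * ‖weakGrad Ω φ i x‖ + P * (‖w‖ * ‖weakGrad Ω φ i x‖)) := by gcongr
      _ = _ := by ring
  have b5 := norm_sq_weakGrad_le_h1Density Ω φ x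
  have b6 := norm_sq_le_h1Density Ω φ x
  have b7 : ‖w‖ ^ 2 ≤ h1Density Ω (m₁ - m₂) x := norm_sq_le_h1Density Ω (m₁ - m₂) x
  set E := t * h1Density Ω (m₁ - m₂) x + h1Density Ω φ x / t with hE
  have hn1 : 0 ≤ t * h1Density Ω (m₁ - m₂) x := mul_nonneg ht.le (h1Density_nonneg _ _ _)
  have hn2 : 0 ≤ h1Density Ω φ x / t := div_nonneg (h1Density_nonneg _ _ _) ht.le
  have b8 : t * ‖w‖ ^ 2 + ‖φ x‖ ^ 2 / t ≤ E := by
    rw [hE]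
    gcongr
  have b9 : ∑ i, 2 * (‖w‖ * ‖weakGrad Ω φ i x‖) ≤ 4 * E := by
    calc _ ≤ ∑ i, (t * ‖w‖ ^ 2 + ‖weakGrad Ω φ i x‖ ^ 2 / t) :=
          Finset.sum_le_sum fun i _ => key _
      _ = 3 * (t * ‖w‖ ^ 2) + (∑ i, ‖weakGrad Ω φ i x‖ ^ 2) / t := by
          simp only [Fin.sum_univ_three]
          ring
      _ ≤ 3 * (t * h1Density Ω (m₁ - m₂) x) + h1Density Ω φ x / t := by gcongr
      _ ≤ 4 * E := by
          rw [hE]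
          linarith
  rw [e1]
  calc _ ≤ γ₂ * P * (‖w‖ * ‖φ x‖) + ∑ i, D * P * (2 * (‖w‖ * ‖weakGrad Ω φ i x‖)) := by
        refine (abs_add_le _ _).trans (add_le_add ?_ ((Finset.abs_sum_le_sum_abs _ _).trans
          (Finset.sum_le_sum fun i _ => b2 i)))
        rwa [abs_neg]
    _ = γ₂ * P * (‖w‖ * ‖φ x‖) + D * P * ∑ i, 2 * (‖w‖ * ‖weakGrad Ω φ i x‖) := by
        rw [Finset.mul_sum]
    _ ≤ γ₂ * P * E + D * P * (4 * E) := by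
        gcongr
        have := key (φ x)
        have : 0 ≤ ‖w‖ * ‖φ x‖ := by positivity
        linarith
    _ = _ := by ring

lemma le_of_forall_weighted_le {c K X Y : ℝ} (hc : 0 < c) (hK : 0 ≤ K)
    (h : ∀ t, 0 < t → c * X ≤ K * (t * Y + X / t)) : X ≤ 4 * K ^ 2 / c ^ 2 * Y := by
  rcases hK.eq_or_lt with rfl | hK
  · have := h 1 one_pos
    rw [zero_mul] at this
    simpa using nonpos_of_mul_nonpos_right this hc
  -- With this t the term K X / t is cX/2, which is absorbed on the left.
  · have h1 := h (2 * K / c) (by positivity)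
    have h2 : K * (2 * K / c * Y + X / (2 * K / c)) = 2 * K ^ 2 / c * Y + c * X / 2 := by
      field_simp
    rw [h2] at h1
    have h3 : c * X ≤ 4 * K ^ 2 / c * Y := by
      have : 4 * K ^ 2 / c * Y = 2 * (2 * K ^ 2 / c * Y) := by ring
      linarith
    have h4 : X = c⁻¹ * (c * X) := by field_simp
    rw [h4]
    calc _ ≤ c⁻¹ * (4 * K ^ 2 / c * Y) := by gcongr
      _ = _ := by field_simp

/-- The quantitative stability of the spin accumulation. -/
theorem IsSpinAccumulation.h1Energy_sub_le (hΩ : IsOpen Ω) (hfin : volume Ω ≠ ∞) {C P J : ℝ}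
    (hC0 : 0 ≤ C) (hC : HasDivBound Ω (fun _ => 1) C)
    (hγ : 0 < γ) (hD₀γ : ∀ᵐ x ∂(volume.restrict Ω), γ ≤ D₀ x)
    (hD₀ : AEStronglyMeasurable D₀ (volume.restrict Ω)) (hD0 : 0 ≤ D)
    (hD : ∀ᵐ x ∂(volume.restrict Ω), |D₀ x| ≤ D) (hβ0 : 0 ≤ β) (hβ1 : β ≤ 1) (hb0 : 0 ≤ β * β')
    (hb : β * β' < 1) (h1 : 0 < γ₁) (h2 : 0 ≤ γ₂) (hje : IsH1 Ω je)
    (hJ : ∀ᵐ x ∂(volume.restrict Ω), ‖je x‖ ≤ J) (hJ0 : 0 ≤ J)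
    (hm₁ : IsH1Sphere Ω m₁) (hm₂ : IsH1Sphere Ω m₂)
    (hs₁ : IsSpinAccumulation Ω D₀ β β' γ₁ γ₂ je m₁ s₁)
    (hs₂ : IsSpinAccumulation Ω D₀ β β' γ₁ γ₂ je m₂ s₂) (hP0 : 0 ≤ P)
    (hP : ∀ᵐ x ∂(volume.restrict Ω), ‖s₁ x‖ ≤ P)
    (hPg : ∀ i, ∀ᵐ x ∂(volume.restrict Ω), ‖weakGrad Ω s₁ i x‖ ≤ P) :
    h1Energy Ω (s₁ - s₂) ≤ (3 * (γ₂ + 4 * D + C) / min γ₁ (γ * (1 - β * β'))) ^ 2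
      * (P ^ 2 + J ^ 2) * h1Energy Ω (m₁ - m₂) := by
  set c := min γ₁ (γ * (1 - β * β')) with hcdef
  have hc : 0 < c := lt_min h1 (mul_pos hγ (by linarith))
  have hb1 : |β * β'| ≤ 1 := abs_le.2 ⟨by linarith, hb.le⟩
  obtain ⟨F₁, hF₁, hdiv₁, -⟩ := hs₁.weak_eq
  obtain ⟨F₂, hF₂, hdiv₂, -⟩ := hs₂.weak_eq
  have hd : IsH1 Ω (s₁ - s₂) := hs₁.isH1.sub hfin hs₂.isH1
  have hw : IsH1 Ω (m₁ - m₂) := hm₁.isH1.sub hfin hm₂.isH1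
  have hA := fun {m} (hm : IsH1Sphere Ω m) (k : Fin 3) =>
    hm.isH1.memLp.coord_smul hje.memLp.aestronglyMeasurable hJ k
  have hdiv : HasWeakDiv Ω (fun k x => je x k • (m₁ - m₂) x) (fun x => F₁ x - F₂ x) := by
    simpa only [Pi.sub_apply, smul_sub] using
      hdiv₁.sub hfin hdiv₂ (hA hm₁) (hA hm₂) hF₁ hF₂
  have hmain : ∀ t, 0 < t → c * h1Energy Ω (s₁ - s₂) ≤ ((γ₂ + 4 * D) * P + C * J)
      * (t * h1Energy Ω (m₁ - m₂) + h1Energy Ω (s₁ - s₂) / t) := by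
    intro t ht
    have e0 := hs₁.energy_sub_le hΩ hfin hγ.le hD₀γ hD₀ hD hb0 hb.le h1.le h2 hm₁ hm₂ hs₂
      hF₁ hdiv₁ hF₂ hdiv₂
    have e1 : ∫ x in Ω, (spinDensity Ω D₀ (β * β') γ₁ γ₂ m₂ s₁ (s₁ - s₂) x
          - spinDensity Ω D₀ (β * β') γ₁ γ₂ m₁ s₁ (s₁ - s₂) x)
        ≤ (γ₂ + 4 * D) * P * (t * h1Energy Ω (m₁ - m₂) + h1Energy Ω (s₁ - s₂) / t) := by
      refine (le_abs_self _).trans ?_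
      have i1 := hw.integrable_h1Density.const_mul t
      have i2 := hd.integrable_h1Density.div_const t
      rw [h1Energy, h1Energy, ← integral_const_mul, ← integral_div, ← integral_add i1 i2,
        ← integral_const_mul, ← Real.norm_eq_abs]
      refine norm_integral_le_of_norm_le ((i1.add i2).const_mul _) ?_
      filter_upwards [hD, hm₁.norm_eq_one, hm₂.norm_eq_one, hP, ae_all_iff.2 hPg]
        with x hx1 hx2 hx3 hx4 hx5
      exact abs_spinDensity_sub_le hx1 hb1 h2 hx2 hx3 hx4 hx5 ht
    have e2 : -(β / 2) * ∫ x in Ω, inner ℝ (F₁ x - F₂ x) ((s₁ - s₂) x)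
        ≤ C * J * (t * h1Energy Ω (m₁ - m₂) + h1Energy Ω (s₁ - s₂) / t) := by
      have h3 := hC je (m₁ - m₂) (s₁ - s₂) (fun x => F₁ x - F₂ x) J t
        hje.memLp.aestronglyMeasurable hJ hJ0 hw hd (hF₁.sub hF₂) hdiv ht
      simp only [one_mul] at h3
      refine le_trans ?_ h3
      refine (le_abs_self _).trans ?_
      rw [abs_mul]
      -- The factor β/2 is at most 1 and is simply dropped.
      refine mul_le_of_le_one_left (abs_nonneg _) ?_
      rw [abs_neg, abs_of_nonneg (by linarith)]
      linarith
    calc _ ≤ _ := e0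
      _ ≤ _ := add_le_add e1 e2
      _ = _ := by ring
  have hK : 0 ≤ (γ₂ + 4 * D) * P + C * J := by positivity
  refine (le_of_forall_weighted_le hc hK hmain).trans ?_
  refine mul_le_mul_of_nonneg_right ?_ (h1Energy_nonneg _ _)
  have hA0 : 0 ≤ γ₂ + 4 * D + C := by positivity
  have hKle : (γ₂ + 4 * D) * P + C * J ≤ (γ₂ + 4 * D + C) * (P + J) := by
    have : 0 ≤ (γ₂ + 4 * D) * J + C * P := by positivity
    linarith
  -- Since 4(P + J)² ≤ 8(P² + J²) and 8 ≤ 3², the factor 3 in the constant suffices.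
  have hK2 : 4 * ((γ₂ + 4 * D) * P + C * J) ^ 2
      ≤ (3 * (γ₂ + 4 * D + C)) ^ 2 * (P ^ 2 + J ^ 2) := by
    have h3 := pow_le_pow_left₀ hK hKle 2
    have h4 : (P + J) ^ 2 ≤ 2 * (P ^ 2 + J ^ 2) := add_sq_le
    have h5 := mul_le_mul_of_nonneg_left h4 (sq_nonneg (γ₂ + 4 * D + C))
    have h6 : 0 ≤ (γ₂ + 4 * D + C) ^ 2 * (P ^ 2 + J ^ 2) := by positivity
    rw [mul_pow] at h3 ⊢
    linarith
  rw [div_pow, div_mul_eq_mul_div]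
  gcongr

end SpinAccumulation

/-! ### Passage between extended and real norms. -/

section NormConversion

variable {Ω : Set R3} {u je : R3 → R3}

lemma IsH1.h1NormSq_eq (hu : IsH1 Ω u) : h1NormSq Ω u = ENNReal.ofReal (h1Energy Ω u) := by
  rw [h1Energy, ofReal_integral_eq_lintegral_ofReal hu.integrable_h1Density
    (.of_forall fun x => h1Density_nonneg Ω u x)]
  have h1 : ∀ v : R3, ENNReal.ofReal (‖v‖ ^ 2) = ‖v‖ₑ ^ 2 := fun v => by
    rw [ENNReal.ofReal_pow (norm_nonneg _), ofReal_norm]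
  have h2 : ∀ x, ENNReal.ofReal (h1Density Ω u x)
      = ‖u x‖ₑ ^ 2 + ∑ i, ‖weakGrad Ω u i x‖ₑ ^ 2 := fun x => by
    rw [h1Density, ENNReal.ofReal_add (by positivity) (by positivity),
      ENNReal.ofReal_sum_of_nonneg fun i _ => by positivity]
    simp only [h1]
  simp only [h2]
  rw [lintegral_add_left' (hu.memLp.aestronglyMeasurable.enorm.pow_const 2),
    lintegral_finsetSum' _ fun i _ =>
      (hu.weakGrad_spec.memLp i).aestronglyMeasurable.enorm.pow_const 2]
  rfl

lemma c0Norm_ne_top (hb : Bornology.IsBounded Ω) (hje : ContinuousOn je (closure Ω)) :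
    c0Norm Ω je ≠ ∞ := by
  obtain ⟨J, hJ⟩ := hb.isCompact_closure.exists_bound_of_continuousOn hje
  refine ne_top_of_le_ne_top (ENNReal.ofReal_ne_top (r := J)) (iSup₂_le fun x hx => ?_)
  rw [← ofReal_norm]
  exact ENNReal.ofReal_le_ofReal (hJ x hx)

lemma norm_le_toReal_of_enorm_le {v : R3} {a : ℝ≥0∞} (ha : a ≠ ∞) (h : ‖v‖ₑ ≤ a) :
    ‖v‖ ≤ a.toReal := by
  simpa using ENNReal.toReal_mono ha h

lemma MeasureTheory.MemLp.exists_ae_abs_le {α : Type*} [MeasurableSpace α] {μ : Measure α}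
    {f : α → ℝ} (hf : MemLp f ∞ μ) : ∃ D, 0 ≤ D ∧ ∀ᵐ x ∂μ, |f x| ≤ D := by
  refine ⟨(eLpNormEssSup f μ).toReal, ENNReal.toReal_nonneg, ?_⟩
  filter_upwards [enorm_ae_le_eLpNormEssSup f μ] with x hx
  have h := hf.eLpNorm_lt_top
  rw [eLpNorm_exponent_top] at h
  simpa using ENNReal.toReal_mono h.ne hx

end NormConversion

/-! ### The main theorem. -/

theorem lemma4p1 (Ω : Set R3) (hΩ : IsBoundedLipschitzDomain Ω)
    (D₀ : R3 → ℝ) (hD₀ : MemLp D₀ ∞ (volume.restrict Ω))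
    (hD₀_pos : ∃ γ : ℝ, 0 < γ ∧ ∀ᵐ x ∂(volume.restrict Ω), γ ≤ D₀ x)
    (β β' γ₁ γ₂ : ℝ) (hβ : 0 < β ∧ β < 1) (hβ' : 0 < β' ∧ β' < 1) (hγ₁ : 0 < γ₁) (hγ₂ : 0 < γ₂) :
    -- the operator `H_s` is well defined
    (∀ je : R3 → R3, IsH1 Ω je → ContinuousOn je (closure Ω) → ∀ m, IsH1Sphere Ω m →
      IsSpinAccumulation Ω D₀ β β' γ₁ γ₂ je m (spinAccumulation Ω D₀ β β' γ₁ γ₂ je m) ∧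
      ∀ s, IsSpinAccumulation Ω D₀ β β' γ₁ γ₂ je m s →
        s =ᵐ[volume.restrict Ω] spinAccumulation Ω D₀ β β' γ₁ γ₂ je m) ∧
    -- the estimate
    ∃ cL : ℝ≥0, ∀ je : R3 → R3, IsH1 Ω je → ContinuousOn je (closure Ω) →
      ∀ m₁ m₂ : R3 → R3, IsCkClosure 2 Ω m₁ → (∀ x ∈ Ω, ‖m₁ x‖ = 1) → IsH1Sphere Ω m₂ →
        h1NormSq Ω (spinAccumulation Ω D₀ β β' γ₁ γ₂ je m₁
            - spinAccumulation Ω D₀ β β' γ₁ γ₂ je m₂) ≤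
          (cL : ℝ≥0∞) ^ 2 *
            (c1Norm Ω (spinAccumulation Ω D₀ β β' γ₁ γ₂ je m₁) ^ 2 + c0Norm Ω je ^ 2) *
            h1NormSq Ω (m₁ - m₂) := by
  have hΩo := hΩ.isOpen
  have hbd := hΩ.isBounded
  have hfin : volume Ω ≠ ∞ := hbd.measure_lt_top.ne
  obtain ⟨γ, hγ, hD₀γ⟩ := hD₀_pos
  obtain ⟨D, hD0, hD⟩ := hD₀.exists_ae_abs_le
  have hD₀m := hD₀.aestronglyMeasurable
  have hb0 : 0 < β * β' := mul_pos hβ.1 hβ'.1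
  have hb1 : β * β' < 1 := mul_lt_one_of_nonneg_of_lt_one_left hβ.1.le hβ.2 hβ'.2.le
  have hsol : ∀ je : R3 → R3, IsH1 Ω je → ContinuousOn je (closure Ω) → ∀ m, IsH1Sphere Ω m →
      IsSpinAccumulation Ω D₀ β β' γ₁ γ₂ je m (spinAccumulation Ω D₀ β β' γ₁ γ₂ je m) :=
    fun je hje hjec m hm => Classical.epsilon_spec
      (exists_isSpinAccumulation hΩo hbd hD₀m hD hγ hD₀γ hb0.le hb1 hγ₁ hγ₂.le hje hjec hm)
  have huniq : ∀ {je m s s' : R3 → R3}, IsH1Sphere Ω m →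
      IsSpinAccumulation Ω D₀ β β' γ₁ γ₂ je m s → IsSpinAccumulation Ω D₀ β β' γ₁ γ₂ je m s' →
      s =ᵐ[volume.restrict Ω] s' := fun hm h h' =>
    h.ae_eq hΩo hfin hγ hD₀γ hD₀m hD hb0.le hb1 hγ₁ hγ₂.le hm h'
  refine ⟨fun je hje hjec m hm => ⟨hsol je hje hjec m hm, fun s hs =>
    huniq hm hs (hsol je hje hjec m hm)⟩, ?_⟩
  obtain ⟨C, hC0, hC⟩ := hΩ.exists_hasDivBound
  have hc : 0 < min γ₁ (γ * (1 - β * β')) := lt_min hγ₁ (mul_pos hγ (by linarith))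
  have hcL : 0 < 3 * (γ₂ + 4 * D + C) / min γ₁ (γ * (1 - β * β')) := by positivity
  refine ⟨⟨_, hcL.le⟩, fun je hje hjec m₁ m₂ hm₁c hm₁1 hm₂ => ?_⟩
  have hm₁ : IsH1Sphere Ω m₁ := ⟨hm₁c.isH1 (by norm_num) hΩo hbd, by
    filter_upwards [ae_restrict_mem hΩo.measurableSet] with x hx using hm₁1 x hx⟩
  have hs₁ := hsol je hje hjec m₁ hm₁
  have hs₂ := hsol je hje hjec m₂ hm₂
  set s₁ := spinAccumulation Ω D₀ β β' γ₁ γ₂ je m₁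
  set s₂ := spinAccumulation Ω D₀ β β' γ₁ γ₂ je m₂
  rw [(hs₁.isH1.sub hfin hs₂.isH1).h1NormSq_eq, (hm₁.isH1.sub hfin hm₂.isH1).h1NormSq_eq]
  have hJtop := c0Norm_ne_top hbd hjec
  -- An infinite C¹ norm makes the right side infinite, unless the energy of m₁ − m₂ is zero and the
  -- convention ∞ · 0 = 0 intervenes. In that case m₁ = m₂ almost everywhere, so uniqueness makes
  -- the left side zero.
  by_cases htop : c1Norm Ω s₁ = ∞
  · rcases (h1Energy_nonneg Ω (m₁ - m₂)).eq_or_lt with h0 | hpos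
    · have hm := hm₁.isH1.ae_eq_of_h1Energy_sub_nonpos hfin hm₂.isH1 h0.ge
      have hs := huniq hm₂ (hs₁.congr hm) hs₂
      have hg0 : IsL2WeakGrad Ω (s₁ - s₂) fun _ _ => 0 :=
        ⟨fun _ => MemLp.zero', fun ψ hψ i => by
          rw [integral_eq_zero_of_ae]
          · simp
          · filter_upwards [hs] with x hx
            simp [hx]⟩
      have hE : h1Energy Ω (s₁ - s₂) = 0 := by
        refine integral_eq_zero_of_ae ?_
        filter_upwards [hs, ae_all_iff.2 fun i => hg0.weakGrad_ae_eq hΩo hfin i] with x hx hgx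
        simp [h1Density, hx, hgx]
      rw [hE, ENNReal.ofReal_zero]
      exact zero_le
    · refine le_top.trans_eq (Eq.symm ?_)
      rw [htop, ENNReal.top_pow two_ne_zero, top_add, ENNReal.mul_top, ENNReal.top_mul]
      · exact (ENNReal.ofReal_pos.2 hpos).ne'
      -- Here the constant must be strictly positive: a zero constant would annihilate the infinite
      -- factor.
      · exact pow_ne_zero 2 (ENNReal.coe_ne_zero.2 (ne_of_gt (NNReal.coe_pos.1 hcL)))
  · have key := hs₁.h1Energy_sub_le hΩo hfin hC0 hC hγ hD₀γ hD₀m hD0 hD hβ.1.le hβ.2.le hb0.le hb1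
      hγ₁ hγ₂.le hje (J := (c0Norm Ω je).toReal) (by
        filter_upwards [ae_restrict_mem hΩo.measurableSet] with x hx
        exact norm_le_toReal_of_enorm_le hJtop
          (le_iSup₂ (f := fun x (_ : x ∈ closure Ω) => ‖je x‖ₑ) x (subset_closure hx)))
      ENNReal.toReal_nonneg hm₁ hm₂ hs₂ (P := (c1Norm Ω s₁).toReal) ENNReal.toReal_nonneg
      ((ae_enorm_le_c1Norm hΩo s₁).mono fun x hx => norm_le_toReal_of_enorm_le htop hx)
      (fun i => (hs₁.isH1.ae_enorm_weakGrad_le_c1Norm hΩo hbd i).mono fun x hx =>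
        norm_le_toReal_of_enorm_le htop hx)
    refine (ENNReal.ofReal_le_ofReal key).trans_eq ?_
    rw [ENNReal.ofReal_mul (by positivity), ENNReal.ofReal_mul (by positivity),
      ENNReal.ofReal_add (by positivity) (by positivity), ENNReal.ofReal_pow hcL.le,
      ENNReal.ofReal_pow ENNReal.toReal_nonneg, ENNReal.ofReal_pow ENNReal.toReal_nonneg,
      ENNReal.ofReal_toReal htop, ENNReal.ofReal_toReal hJtop]
    congr 3
    exact ENNReal.ofReal_eq_coe_nnreal hcL.le
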